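/- Let $B_n$ ($n\ge 0$) be the group of signed permutations $\pi$ of $\{\pm1,\ldots,\pm n\}$ (so $\pi_{-i}=-\pi_i$, where $\pi_i=\pi(i)$), with simple reflections $s_0=(1\;{-1})$ and $s_i=(i\;\,i{+}1)({-i}\;\,{-i{-}1})$ for $1\le i<n$, length function $\ell$, and reflections $(a\;{-a})$, and $(a\;b)({-a}\;{-b})$ with $|a|\ne|b|$. The weak order is defined by $u\le w$ if and only if $\operatorname{inv}(u)\subseteq\operatorname{inv}(w)$, where $\operatorname{inv}(w)$ is the set of reflections $t$ with $\ell(tw)<\ell(w)$. An element is join-irreducible if it covers exactly one element. The canonical join representation of $x$ is the antichain $X$ with $x=\bigvee X$ such that, whenever $x=\bigvee X'$, the order ideal generated by $X'$ contains the order ideal generated by $X$. An arc $\alpha$ on the points $-n<\cdots<-1<1<\cdots<n$ of a vertical line (considered up to combinatorial equivalence) is given by its endpoints $p<q$ and a partition of the points strictly between $p$ and $q$ into the set $L(\alpha)$ of points left of $\alpha$ and the set $R(\alpha)$ of points right of $\alpha$. Its image $-\alpha$ under the half turn $x\mapsto-x$ has endpoints $-q<-p$, with $L(-\alpha)=-R(\alpha)$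 and $R(-\alpha)=-L(\alpha)$. Two arcs are compatible if they do not share their upper endpoint, do not share their lower endpoint, and do not cross. A symmetric arc is an arc with $-\alpha=\alpha$; a symmetric pair is a set $\{\alpha,-\alpha\}$ with $-\alpha\neq\alpha$ and $\alpha,-\alpha$ compatible. For $\pi\in B_n$, the diagram $\delta(\pi)$ has one arc for each descent $\pi_i>\pi_{i'}$ at adjacent positions $i<i'$ of the long one-line notation $\pi_{-n}\cdots\pi_{-1}\pi_1\cdots\pi_n$; this arc connects $\pi_i$ to $\pi_{i'}$, and a value strictly between $\pi_{i'}$ and $\pi_i$ is left of it if it occurs before position $i$, and right of it if it occurs after position $i'$. To a symmetric arc or symmetric pair $A$ associate the signed permutation $j_A$ whose one-line notation $\pi_1\cdots\pi_n$ is as follows (sets are written in increasing order; $a\cdots b$ is an increasing run of consecutive integers, possibly empty). If $A=\{\alpha\}$ is a symmetric arc with endpoints $-p<p$: \[(-p)\,R(\alpha)\,(p+1)\cdots n.\] If $A=\{\alpha,-\alpha\}$ is a symmetric pair, name its arcs so that $\alpha$ is the arc connecting positive points if there is one, and so that $\alpha$ is the one to the right of the other if each arc connects a negative point to a positive point, and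 let $p<q$ be the endpoints of $\alpha$. Then $j_A$ is \[1\cdots(p-1)\,L(\alpha)\,q\,p\,R(\alpha)\,(q+1)\cdots n\quad\text{if } 0<p<q,\] \[[(0,-p)\cap L(\alpha)\cap-L(\alpha)]\,[(-p,q)\cap L(\alpha)]\,q\,p\,R(\alpha)\,(q+1)\cdots n\quad\text{if } p<0<-p<q,\] \[[(0,q)\cap L(\alpha)\cap-L(\alpha)]\,q\,p\,R(\alpha)\,[(q,-p)\cap-L(\alpha)]\,(-p+1)\cdots n\quad\text{if } p<0<q<-p.\] \textbf{Theorem.} Let $\pi\in B_n$. For each symmetric arc or symmetric pair $A\subseteq\delta(\pi)$, the signed permutation $j_A$ is well defined, and it is the unique join-irreducible element $j$ of $B_n$ with $\delta(j)=A$. The canonical join representation of $\pi$ in the weak order is the set of all $j_A$, where $A$ runs over the symmetric arcs and symmetric pairs of arcs contained in $\delta(\pi)$. -/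

import Mathlib

noncomputable section

namespace TypeB

/-- The points `-n, …, -1, 1, …, n`, with the order inherited from `ℤ`. -/
abbrev Pt (n : ℕ) : Type := {x : ℤ // x ≠ 0 ∧ |x| ≤ (n : ℤ)}

instance instFinitePt (n : ℕ) : Finite (Pt n) :=
  ((Set.finite_Icc (-(n : ℤ)) (n : ℤ)).subset
    (fun _ hx => abs_le.mp hx.2 : {x : ℤ | x ≠ 0 ∧ |x| ≤ (n : ℤ)} ⊆ _)).to_subtype

instance instNegPt (n : ℕ) : Neg (Pt n) :=
  ⟨fun x => ⟨-x.1, neg_ne_zero.mpr x.2.1, by rw [abs_neg]; exact x.2.2⟩⟩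

theorem neg_lt_neg_pt {n : ℕ} {x y : Pt n} (h : x < y) : -y < -x :=
  neg_lt_neg (show x.1 < y.1 from h)

theorem neg_neg_pt {n : ℕ} (x : Pt n) : - -x = x := Subtype.ext (neg_neg x.1)

/-! ### Signed permutations and the weak order -/

/-- The group of signed permutations, inside all permutations of the points. -/
def signedPermGroup (n : ℕ) : Subgroup (Equiv.Perm (Pt n)) where
  carrier := {π | ∀ x, π (-x) = -π x}
  one_mem' := fun _ => rfl
  mul_mem' := by
    intro a b ha hb x
    rw [Equiv.Perm.mul_apply, Equiv.Perm.mul_apply, hb, ha]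
  inv_mem' := by
    intro a ha x
    rw [Equiv.Perm.inv_eq_iff_eq, ha]; exact congrArg _ (a.apply_symm_apply x).symm

/-- The group `B_n`; the product is composition. -/
abbrev SignedPerm (n : ℕ) : Type := ↥(signedPermGroup n)

/-- The simple reflections `s₀ = (1 -1)` and `s_i = (i i+1)(-i -i-1)`, `1 ≤ i ≤ n - 1`. -/
def IsSimpleReflection {n : ℕ} (s : SignedPerm n) : Prop :=
  (∃ a : Pt n, a.1 = 1 ∧ s.1 = Equiv.swap a (-a)) ∨
  (∃ a b : Pt n, 0 < a.1 ∧ b.1 = a.1 + 1 ∧ s.1 = Equiv.swap a b * Equiv.swap (-a) (-b))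

/-- The reflections `(i -i)`, and `(i j)(-i -j)` for `|i| ≠ |j|`. -/
def IsReflection {n : ℕ} (t : SignedPerm n) : Prop :=
  (∃ a : Pt n, t.1 = Equiv.swap a (-a)) ∨
  (∃ a b : Pt n, |a.1| ≠ |b.1| ∧ t.1 = Equiv.swap a b * Equiv.swap (-a) (-b))

/-- The length of `w` in the alphabet of simple reflections. -/
def coxLength {n : ℕ} (w : SignedPerm n) : ℕ :=
  sInf {k | ∃ l : List (SignedPerm n), l.length = k ∧ (∀ s ∈ l, IsSimpleReflection s) ∧ l.prod = w}

/-- The set of (left) inversions of `w`. -/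
def inversions {n : ℕ} (w : SignedPerm n) : Set (SignedPerm n) :=
  {t | IsReflection t ∧ coxLength (t * w) < coxLength w}

/-- The (right) weak order: `u ≤ w` when every inversion of `u` is an inversion of `w`. -/
instance weakOrder (n : ℕ) : Preorder (SignedPerm n) := Preorder.lift inversions

/-! ### Canonical join representations -/

/-- `j` covers exactly one element. -/
def IsJoinIrreducible {L : Type*} [Preorder L] (j : L) : Prop := ∃! k, k ⋖ j

/-- `X` is the canonical join representation of `x`: an antichain with join `x` such that the
order ideal it generates lies in the one generated by any other set with join `x`. -/
structure IsCanonicalJoinRep {L : Type*} [Preorder L] (x : L) (X : Set L) : Prop where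
  antichain : IsAntichain (· ≤ ·) X
  isLUB : IsLUB X x
  minimal : ∀ X' : Set L, IsLUB X' x → lowerClosure X ≤ lowerClosure X'

/-! ### Arcs and arc diagrams -/

/-- An arc up to combinatorial equivalence: its two endpoints, and the set of those points
strictly between them (in height) that lie to the right of the arc. -/
@[ext] structure Arc (n : ℕ) where
  lower : Pt n
  upper : Pt n
  right : Set (Pt n)
  lower_lt_upper : lower < upper
  right_subset : right ⊆ Set.Ioo lower upper

namespace Arc

variable {n : ℕ}

/-- The points between the endpoints that lie to the left of the arc. -/
def left (α : Arc n) : Set (Pt n) := Set.Ioo α.lower α.upper \ α.right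

/-- The image of an arc under the half turn `x ↦ -x`, which exchanges left and right. -/
instance instNegArc : Neg (Arc n) where
  neg α :=
    { lower := -α.upper
      upper := -α.lower
      right := {x | -x ∈ α.left}
      lower_lt_upper := neg_lt_neg_pt α.lower_lt_upper
      right_subset := by
        intro x hx
        have h := hx.1
        constructor
        · simpa only [neg_neg_pt] using neg_lt_neg_pt h.2
        · simpa only [neg_neg_pt] using neg_lt_neg_pt h.1 }

def IsEndpoint (α : Arc n) (x : Pt n) : Prop := x = α.lower ∨ x = α.upper

/-- At the height of the point `x`, the arc `α` is strictly to the right of the arc `β`: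
`α` ends at `x` or passes right of it, `β` ends at `x` or passes left of it, not both end there. -/
def RightAt (α β : Arc n) (x : Pt n) : Prop :=
  (x ∈ α.left ∨ α.IsEndpoint x) ∧ (x ∈ β.right ∨ β.IsEndpoint x) ∧
    ¬ (α.IsEndpoint x ∧ β.IsEndpoint x)

/-- The arcs have distinct upper endpoints and distinct lower endpoints, and they do not cross:
neither passes from one side of the other to the opposite side. -/
def Compatible (α β : Arc n) : Prop :=
  α.upper ≠ β.upper ∧ α.lower ≠ β.lower ∧ ¬ ((∃ x, α.RightAt β x) ∧ (∃ y, β.RightAt α y))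

/-- For compatible arcs: `α` is to the right of `β`. -/
def RightOf (α β : Arc n) : Prop := ∃ x, α.RightAt β x

end Arc

/-- The arc diagram `δ(π)`: for each descent `π_i > π_{i'}` at adjacent positions `i < i'` of
the long one-line notation, an arc from `π_i` down to `π_{i'}` that has on its right those
intermediate values that occur after position `i'` (and on its left those before `i`). -/
def delta {n : ℕ} (π : SignedPerm n) : Set (Arc n) :=
  {α | ∃ i i' : Pt n, i ⋖ i' ∧ α.upper = π.1 i ∧ α.lower = π.1 i' ∧
    α.right = {x | π.1 i' < x ∧ x < π.1 i ∧ ∃ k, i' < k ∧ π.1 k = x}}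

/-- The set `A` consists of one symmetric arc. -/
def IsSymmetricArc {n : ℕ} (A : Set (Arc n)) : Prop := ∃ α : Arc n, -α = α ∧ A = {α}

/-- The set `A` is a symmetric pair of arcs. -/
def IsSymmetricPair {n : ℕ} (A : Set (Arc n)) : Prop :=
  ∃ α : Arc n, -α ≠ α ∧ α.Compatible (-α) ∧ A = {α, -α}

/-- The symmetric arcs and symmetric pairs of arcs of an arc diagram `D`. -/
def symmetricParts {n : ℕ} (D : Set (Arc n)) : Set (Set (Arc n)) :=
  {A | (IsSymmetricArc A ∨ IsSymmetricPair A) ∧ A ⊆ D}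

/-! ### The join-irreducible element of a symmetric arc or pair -/

/-- The elements of a set of points, in increasing order. -/
def increasing {n : ℕ} (S : Set (Pt n)) : List (Pt n) := S.toFinite.toFinset.sort (· ≤ ·)

/-- The (short) one-line notation `π_1 π_2 ⋯ π_n`. -/
def oneLine {n : ℕ} (π : SignedPerm n) : List (Pt n) :=
  (increasing {i : Pt n | 0 < i.1}).map π.1

/-- The arc `α` of the symmetric arc or pair `{α, -α}` in terms of which the corresponding
join-irreducible element is written: the symmetric arc itself, or the upper arc of a
non-overlapping pair, or the right arc of an overlapping pair. -/
def IsPreferred {n : ℕ} (α : Arc n) : Prop :=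
  -α = α ∨ 0 < α.lower.1 ∨ (-α ≠ α ∧ α.lower.1 < 0 ∧ 0 < α.upper.1 ∧ α.RightOf (-α))

/-- The one-line notation of the join-irreducible element, for a preferred arc `α` with
endpoints `p < q`; the four cases are `p = -q`, `0 < p < q`, `p < 0 < -p < q`
and `p < 0 < q < -p`. -/
def jiWord {n : ℕ} (α : Arc n) : List (Pt n) :=
  let p := α.lower
  let q := α.upper
  let L := α.left
  let R := α.right
  if p = -q then
    [p] ++ increasing R ++ increasing {x | q < x}
  else if 0 < p.1 then
    increasing {x | 0 < x.1 ∧ x < p} ++ increasing L ++ [q, p] ++ increasing R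
      ++ increasing {x | q < x}
  else if -p < q then
    increasing {x | 0 < x.1 ∧ x < -p ∧ x ∈ L ∧ -x ∈ L} ++ increasing {x | -p < x ∧ x < q ∧ x ∈ L}
      ++ [q, p] ++ increasing R ++ increasing {x | q < x}
  else
    increasing {x | 0 < x.1 ∧ x < q ∧ x ∈ L ∧ -x ∈ L} ++ [q, p] ++ increasing R
      ++ increasing {x | q < x ∧ x < -p ∧ -x ∈ L} ++ increasing {x | -p < x}

/-- The signed permutation `j` corresponds to the symmetric arc or pair `A`. -/
def Corresponds {n : ℕ} (j : SignedPerm n) (A : Set (Arc n)) : Prop :=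
  ∃ α ∈ A, IsPreferred α ∧ oneLine j = jiWord α

end TypeB

end

open TypeB

/-!
A signed permutation `π` is determined by its set of inverted pairs `a < b` of values, `b` placed
before `a`, and the weak order is inclusion of these sets. An arc of `δ(π)` carries its own set of
inverted pairs: those whose smaller value is the lower endpoint or right of the arc, and whose
larger value is the upper endpoint or left of it. A signed permutation lies above `π` exactly when
it inverts the pairs of all arcs of `π`. Undoing the descent of an arc `α` of `π`, and with it that
of `-α`, yields the largest element below `π` that does not invert the endpoints of `α`. If
`δ(j) = {α, -α}`, it follows that `j` is join-irreducible and that an element below `π` is above `j`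
as soon as it inverts the endpoints of `α`. Every set with join `π` contains an element that inverts
them, so these `j` form the canonical join representation.

Such a `j` exists for each symmetric arc or pair because the points to the right of a preferred arc
`α`, together with its lower endpoint and some points above `α`, form a set `S` disjoint from `-S`,
and the permutation with the increasing runs `-S`, the rest, and `S` has only one arc that descends
into `S`, namely `α`.
-/

namespace TypeB

variable {n : ℕ}

namespace Pt

instance instInvolutiveNeg : InvolutiveNeg (Pt n) where
  neg_neg := neg_neg_pt

@[simp] theorem coe_neg (x : Pt n) : (-x).1 = -x.1 := rfl

theorem neg_ne_self (x : Pt n) : -x ≠ x := fun h =>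
  x.2.1 (self_eq_neg.mp (congrArg Subtype.val h).symm)

theorem neg_lt_neg_iff {x y : Pt n} : -x < -y ↔ y < x := _root_.neg_lt_neg_iff (α := ℤ)

theorem neg_le_neg_iff {x y : Pt n} : -x ≤ -y ↔ y ≤ x := _root_.neg_le_neg_iff (α := ℤ)

theorem neg_covBy_neg_iff {x y : Pt n} : -x ⋖ -y ↔ y ⋖ x := by
  let negIso : Pt n ≃o (Pt n)ᵒᵈ :=
    ⟨(Equiv.neg (Pt n)).trans OrderDual.toDual, neg_le_neg_iff⟩
  exact toDual_covBy_toDual_iff.symm.trans (apply_covBy_apply_iff negIso)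

theorem covBy_iff_coe {x y : Pt n} : x ⋖ y ↔ y.1 = x.1 + 1 ∨ (x.1 = -1 ∧ y.1 = 1) := by
  have hx := abs_le.mp x.2.2
  have hy := abs_le.mp y.2.2
  have := x.2.1
  have := y.2.1
  constructor
  · intro h
    have hlt : x.1 < y.1 := h.lt
    have hgap : ∀ z : ℤ, z ≠ 0 → x.1 < z → ¬ z < y.1 := fun z hz hxz hzy =>
      h.2 (c := ⟨z, hz, abs_le.mpr ⟨by omega, by omega⟩⟩) hxz hzy
    have := hgap (x.1 + 1)
    have := hgap 1
    omega
  · refine fun h => ⟨show x.1 < y.1 by omega, fun z hxz hzy => ?_⟩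
    have hz0 := z.2.1
    rw [← Subtype.coe_lt_coe] at hxz hzy
    omega

end Pt

theorem perm_eq_one_of_strictMono {α : Type*} [LinearOrder α] [WellFoundedLT α]
    {σ : Equiv.Perm α} (hσ : StrictMono σ) : σ = 1 :=
  Equiv.coe_fn_injective <| (StrictMono.range_inj hσ strictMono_id).mp <| by
    rw [σ.surjective.range_eq, Set.range_id]

theorem apply_neg (π : SignedPerm n) (x : Pt n) : π.1 (-x) = -π.1 x := π.2 x

/-- The position of the value `x` in the long one-line notation of `π`. -/
def pos (π : SignedPerm n) (x : Pt n) : Pt n := π⁻¹.1 x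

@[simp] theorem pos_apply (π : SignedPerm n) (x : Pt n) : pos π (π.1 x) = x :=
  π.1.symm_apply_apply x

@[simp] theorem apply_pos (π : SignedPerm n) (x : Pt n) : π.1 (pos π x) = x :=
  π.1.apply_symm_apply x

theorem pos_neg (π : SignedPerm n) (x : Pt n) : pos π (-x) = -pos π x := apply_neg π⁻¹ x

theorem pos_injective (π : SignedPerm n) : Function.Injective (pos π) := π⁻¹.1.injective

theorem pos_mul (u v : SignedPerm n) (x : Pt n) : pos (u * v) x = pos v (pos u x) := by
  simp only [pos, mul_inv_rev, Subgroup.coe_mul, Equiv.Perm.mul_apply]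

/-- The pairs of values `a < b` that are inverted in the long one-line notation of `π`: the value
`b` occurs before `a`. -/
def invPairs (π : SignedPerm n) : Set (Pt n × Pt n) := {c | c.1 < c.2 ∧ pos π c.2 < pos π c.1}

theorem neg_mem_invPairs {π : SignedPerm n} {a b : Pt n} :
    (-b, -a) ∈ invPairs π ↔ (a, b) ∈ invPairs π := by
  simp only [invPairs, Set.mem_ofPred_eq, pos_neg, Pt.neg_lt_neg_iff]

theorem invPairs_trans {π : SignedPerm n} {a b c : Pt n} (hab : (a, b) ∈ invPairs π)
    (hbc : (b, c) ∈ invPairs π) : (a, c) ∈ invPairs π :=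
  ⟨hab.1.trans hbc.1, hbc.2.trans hab.2⟩

theorem pos_lt_pos_iff {π : SignedPerm n} {a b : Pt n} :
    pos π a < pos π b ↔ (b, a) ∈ invPairs π ∨ (a < b ∧ (a, b) ∉ invPairs π) := by
  have : a ≠ b → pos π a ≠ pos π b := (pos_injective π).ne
  simp only [invPairs, Set.mem_ofPred_eq]
  grind

theorem pos_lt_pos_of_notMem_invPairs {π : SignedPerm n} {a b : Pt n} (hab : a < b)
    (h : (a, b) ∉ invPairs π) : pos π a < pos π b := pos_lt_pos_iff.mpr (Or.inr ⟨hab, h⟩)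

theorem invPairs_injective : Function.Injective (invPairs (n := n)) := by
  intro u w h
  have hmono : StrictMono (w⁻¹ * u).1 := by
    intro x y hxy
    change pos w (u.1 x) < pos w (u.1 y)
    rw [pos_lt_pos_iff, ← h, ← pos_lt_pos_iff, pos_apply, pos_apply]
    exact hxy
  exact (inv_mul_eq_one.mp (Subtype.ext (perm_eq_one_of_strictMono hmono))).symm

/-! ### Reflections -/

/-- The map that exchanges `a` with `b` and `-a` with `-b`. -/
def reflectFun (a b x : Pt n) : Pt n :=
  if x = a then b else if x = b then a else if x = -a then -b else if x = -b then -a else x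

theorem reflectFun_involutive (a b : Pt n) : Function.Involutive (reflectFun a b) := by
  intro x
  simp only [reflectFun]
  grind [neg_neg, Pt.neg_ne_self]

theorem reflectFun_neg (a b x : Pt n) : reflectFun a b (-x) = -reflectFun a b x := by
  simp only [reflectFun]
  grind [neg_neg, Pt.neg_ne_self]

/-- The reflection exchanging `a` with `b` and `-a` with `-b`. This covers both kinds of
reflections, since `(a -a)` is the case `b = -a`. -/
def reflect (a b : Pt n) : SignedPerm n :=
  ⟨(reflectFun_involutive a b).toPerm, reflectFun_neg a b⟩

theorem reflect_apply (a b x : Pt n) :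
    (reflect a b).1 x = if x = a then b else if x = b then a else if x = -a then -b else
      if x = -b then -a else x := rfl

theorem reflect_apply_left (a b : Pt n) : (reflect a b).1 a = b := if_pos rfl

theorem reflect_comm (a b : Pt n) : reflect a b = reflect b a := by
  refine Subtype.ext (Equiv.ext fun x => ?_)
  simp only [reflect_apply]
  grind

theorem reflect_neg_neg (a b : Pt n) : reflect (-a) (-b) = reflect a b := by
  refine Subtype.ext (Equiv.ext fun x => ?_)
  simp only [reflect_apply, neg_neg]
  grind [neg_neg, Pt.neg_ne_self]

theorem reflect_mul_self (a b : Pt n) : reflect a b * reflect a b = 1 :=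
  Subtype.ext (Equiv.ext (reflectFun_involutive a b))

theorem reflect_inv (a b : Pt n) : (reflect a b)⁻¹ = reflect a b :=
  inv_eq_of_mul_eq_one_left (reflect_mul_self a b)

theorem pos_reflect (a b x : Pt n) : pos (reflect a b) x = (reflect a b).1 x := by
  rw [pos, reflect_inv]

theorem reflect_mul (s : SignedPerm n) (a b : Pt n) :
    reflect a b * s = s * reflect (pos s a) (pos s b) := by
  refine Subtype.ext (Equiv.ext fun x => ?_)
  change (reflect a b).1 (s.1 x) = s.1 ((reflect (pos s a) (pos s b)).1 x)
  have eq_pos_iff (c : Pt n) : x = pos s c ↔ s.1 x = c := by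
    rw [← s.1.injective.eq_iff, apply_pos]
  simp only [reflect_apply, ← pos_neg, eq_pos_iff, apply_ite s.1, apply_pos]

theorem coe_reflect_neg (a : Pt n) : (reflect a (-a)).1 = Equiv.swap a (-a) := by
  ext1 x
  rw [reflect_apply, Equiv.swap_apply_def]
  grind [neg_neg]

theorem coe_reflect {a b : Pt n} (hab : |a.1| ≠ |b.1|) :
    (reflect a b).1 = Equiv.swap a b * Equiv.swap (-a) (-b) := by
  have : a ≠ b := fun h => hab (by rw [h])
  have : a ≠ -b := fun h => hab (by rw [h, Pt.coe_neg, abs_neg])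
  have := Pt.neg_ne_self a
  have := Pt.neg_ne_self b
  ext1 x
  rw [reflect_apply, Equiv.Perm.mul_apply, Equiv.swap_apply_def, Equiv.swap_apply_def]
  grind [neg_neg, neg_inj]

theorem isReflection_iff {t : SignedPerm n} :
    IsReflection t ↔ ∃ a b, a < b ∧ t = reflect a b := by
  constructor
  · intro ht
    obtain ⟨a, b, hab, rfl⟩ : ∃ a b, a ≠ b ∧ t = reflect a b := by
      rcases ht with ⟨a, h⟩ | ⟨a, b, hab, h⟩
      · exact ⟨a, -a, (Pt.neg_ne_self a).symm, Subtype.ext (h.trans (coe_reflect_neg a).symm)⟩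
      · exact ⟨a, b, fun g => hab (by rw [g]), Subtype.ext (h.trans (coe_reflect hab).symm)⟩
    rcases hab.lt_or_gt with h | h
    · exact ⟨a, b, h, rfl⟩
    · exact ⟨b, a, h, reflect_comm a b⟩
  · rintro ⟨a, b, hab, rfl⟩
    by_cases h : |a.1| = |b.1|
    · have hb : b = -a := Subtype.ext (by
        rw [Pt.coe_neg, ← neg_eq_iff_eq_neg]
        exact ((abs_eq_abs.mp h).resolve_left (Subtype.coe_ne_coe.mpr hab.ne)).symm)
      exact Or.inl ⟨a, by rw [hb, coe_reflect_neg]⟩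
    · exact Or.inr ⟨a, b, h, coe_reflect h⟩

theorem isSimpleReflection_iff {s : SignedPerm n} :
    IsSimpleReflection s ↔ ∃ i i', i ⋖ i' ∧ s = reflect i i' := by
  have coe_reflect_of_pos {a b : Pt n} (ha : 0 < a.1) (hab : b.1 = a.1 + 1) :
      (reflect a b).1 = Equiv.swap a b * Equiv.swap (-a) (-b) := coe_reflect (by
    rw [abs_of_pos ha, abs_of_pos (by omega)]
    omega)
  constructor
  · rintro (⟨a, ha, h⟩ | ⟨a, b, ha, hab, h⟩)
    · refine ⟨-a, a, Pt.covBy_iff_coe.mpr (Or.inr ⟨by simp [ha], ha⟩), Subtype.ext ?_⟩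
      rw [h, reflect_comm, coe_reflect_neg]
    · exact ⟨a, b, Pt.covBy_iff_coe.mpr (Or.inl hab),
        Subtype.ext (h.trans (coe_reflect_of_pos ha hab).symm)⟩
  · rintro ⟨i, i', hcov, rfl⟩
    have hi0 := i.2.1
    have hi'0 := i'.2.1
    rcases Pt.covBy_iff_coe.mp hcov with h | ⟨hi, hi'⟩
    · rcases hi0.lt_or_gt with hi | hi
      · refine Or.inr ⟨-i', -i, ?_, ?_, ?_⟩
        · rw [Pt.coe_neg]; omega
        · rw [Pt.coe_neg, Pt.coe_neg]; omega
        · rw [← reflect_neg_neg, reflect_comm, coe_reflect_of_pos] <;>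
            simp only [Pt.coe_neg] <;> omega
      · exact Or.inr ⟨i, i', hi, h, coe_reflect_of_pos hi h⟩
    · obtain rfl : i = -i' := Subtype.ext (by rw [Pt.coe_neg, hi, hi'])
      exact Or.inl ⟨i', hi', by rw [reflect_comm, coe_reflect_neg]⟩

theorem reflect_lt_reflect_iff {i i' x y : Pt n} (hcov : i ⋖ i') (hxy : x < y) :
    (reflect i i').1 x < (reflect i i').1 y ↔ (x, y) ≠ (i, i') ∧ (x, y) ≠ (-i', -i) := by
  have := x.2.1
  have := y.2.1
  have := i.2.1
  have := i'.2.1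
  have := Pt.covBy_iff_coe.mp hcov
  simp only [reflect_apply, ne_eq, Prod.mk.injEq]
  split_ifs <;> simp only [← Subtype.coe_lt_coe, Subtype.ext_iff, Pt.coe_neg] at * <;> omega

theorem invPairs_mul_reflect {π : SignedPerm n} {i i' : Pt n} (hcov : i ⋖ i')
    (hdesc : π.1 i' < π.1 i) :
    invPairs (π * reflect i i') = invPairs π \ {(π.1 i', π.1 i), (-π.1 i, -π.1 i')} := by
  ext ⟨a, b⟩
  obtain ⟨x, rfl⟩ := π.1.surjective a
  obtain ⟨y, rfl⟩ := π.1.surjective b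
  simp only [invPairs, Set.mem_sdiff, Set.mem_insert_iff, Set.mem_singleton_iff, Set.mem_ofPred_eq,
    pos_mul, pos_reflect, pos_apply, ← apply_neg, Prod.mk.injEq, π.1.injective.eq_iff]
  rcases lt_trichotomy x y with h | rfl | h
  · have := reflect_lt_reflect_iff hcov h
    have := neg_lt_neg_pt hdesc
    have := (reflect i i').1.injective.ne h.ne
    grind [apply_neg]
  · simp
  · have := reflect_lt_reflect_iff hcov h
    grind

theorem reflect_eq_of_mem_invPairs {i i' a b : Pt n} (hcov : i ⋖ i')
    (h : (a, b) ∈ invPairs (reflect i i')) : reflect a b = reflect i i' := by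
  have hlt := h.2.not_gt
  rw [pos_reflect, pos_reflect, reflect_lt_reflect_iff hcov h.1, not_and_or, not_ne_iff,
    not_ne_iff, Prod.mk.injEq, Prod.mk.injEq] at hlt
  rcases hlt with ⟨rfl, rfl⟩ | ⟨rfl, rfl⟩
  · rfl
  · rw [reflect_neg_neg, reflect_comm]

/-! ### Length and the weak order -/

theorem exists_descent {π : SignedPerm n} (hπ : π ≠ 1) :
    ∃ i i' : Pt n, i ⋖ i' ∧ π.1 i' < π.1 i := by
  classical
  let _ : Fintype (Pt n) := Fintype.ofFinite _
  let _ : LocallyFiniteOrder (Pt n) := Fintype.toLocallyFiniteOrder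
  by_contra! h
  have hmono : Monotone π.1 := (monotone_iff_forall_covBy _).mpr h
  exact hπ (Subtype.ext
    (perm_eq_one_of_strictMono (hmono.strictMono_of_injective π.1.injective)))

theorem closure_isSimpleReflection :
    Submonoid.closure {s : SignedPerm n | IsSimpleReflection s} = ⊤ := by
  refine eq_top_iff.mpr fun π _ => ?_
  induction hI : invPairs π using WellFoundedLT.induction generalizing π with
  | _ I ih =>
  subst hI
  by_cases hπ : π = 1
  · exact hπ ▸ one_mem _
  obtain ⟨i, i', hcov, hdesc⟩ := exists_descent hπ
  have hinv : (π.1 i', π.1 i) ∈ invPairs π := ⟨hdesc, by simpa using hcov.lt⟩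
  have hlt : invPairs (π * reflect i i') < invPairs π := by
    rw [invPairs_mul_reflect hcov hdesc]
    exact Set.sdiff_ssubset_left_iff.mpr ⟨_, hinv, Or.inl rfl⟩
  have hs : reflect i i' ∈ Submonoid.closure {s : SignedPerm n | IsSimpleReflection s} :=
    Submonoid.subset_closure (isSimpleReflection_iff.mpr ⟨i, i', hcov, rfl⟩)
  simpa only [mul_assoc, reflect_mul_self, mul_one] using mul_mem (ih _ hlt _ trivial rfl) hs

theorem coxLength_prod_le {l : List (SignedPerm n)} (hl : ∀ s ∈ l, IsSimpleReflection s) :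
    coxLength l.prod ≤ l.length := Nat.sInf_le ⟨l, rfl, hl, rfl⟩

theorem exists_reduced_word (π : SignedPerm n) :
    ∃ l : List (SignedPerm n), l.length = coxLength π ∧ (∀ s ∈ l, IsSimpleReflection s) ∧
      l.prod = π := by
  have hπ : π ∈ Submonoid.closure {s : SignedPerm n | IsSimpleReflection s} :=
    closure_isSimpleReflection ▸ Submonoid.mem_top π
  obtain ⟨l, hl, hp⟩ := Submonoid.exists_list_of_mem_closure hπ
  exact Nat.sInf_mem (s := {k | ∃ l : List (SignedPerm n), l.length = k ∧
    (∀ s ∈ l, IsSimpleReflection s) ∧ l.prod = π}) ⟨l.length, l, rfl, hl, hp⟩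

theorem strong_exchange (l : List (SignedPerm n)) (hl : ∀ s ∈ l, IsSimpleReflection s)
    {a b : Pt n} (hab : (a, b) ∈ invPairs l.prod) :
    ∃ l' : List (SignedPerm n), l'.length < l.length ∧ (∀ s ∈ l', IsSimpleReflection s) ∧
      l'.prod = reflect a b * l.prod := by
  induction l generalizing a b with
  | nil => exact absurd hab.1 hab.2.asymm
  | cons s w ih =>
    obtain ⟨hs, hw⟩ := List.forall_mem_cons.mp hl
    rw [List.prod_cons] at hab ⊢
    by_cases hsab : (a, b) ∈ invPairs s
    · obtain ⟨i, i', hcov, rfl⟩ := isSimpleReflection_iff.mp hs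
      refine ⟨w, Nat.lt_succ_self _, hw, ?_⟩
      rw [reflect_eq_of_mem_invPairs hcov hsab, ← mul_assoc, reflect_mul_self, one_mul]
    · have hpos : (pos s a, pos s b) ∈ invPairs w.prod :=
        ⟨pos_lt_pos_of_notMem_invPairs hab.1 hsab, by simpa only [pos_mul] using hab.2⟩
      obtain ⟨l', hlen, hl', hprod⟩ := ih hw hpos
      refine ⟨s :: l', Nat.succ_lt_succ hlen, List.forall_mem_cons.mpr ⟨hs, hl'⟩, ?_⟩
      rw [List.prod_cons, hprod, ← mul_assoc, ← mul_assoc, reflect_mul]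

theorem coxLength_reflect_mul_lt {w : SignedPerm n} {a b : Pt n} (h : (a, b) ∈ invPairs w) :
    coxLength (reflect a b * w) < coxLength w := by
  obtain ⟨l, hlen, hl, rfl⟩ := exists_reduced_word w
  obtain ⟨l', hlen', hl', hprod⟩ := strong_exchange l hl h
  rw [← hprod, ← hlen]
  exact (coxLength_prod_le hl').trans_lt hlen'

theorem coxLength_reflect_mul_lt_iff {w : SignedPerm n} {a b : Pt n} (hab : a < b) :
    coxLength (reflect a b * w) < coxLength w ↔ (a, b) ∈ invPairs w := by
  refine ⟨fun hlt => ?_, coxLength_reflect_mul_lt⟩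
  by_contra h
  have hinv : (a, b) ∈ invPairs (reflect a b * w) := by
    refine ⟨hab, ?_⟩
    rw [pos_mul, pos_mul, pos_reflect, pos_reflect, reflect_apply_left, reflect_comm,
      reflect_apply_left]
    exact pos_lt_pos_of_notMem_invPairs hab h
  have := coxLength_reflect_mul_lt hinv
  rw [← mul_assoc, reflect_mul_self, one_mul] at this
  exact hlt.asymm this

theorem reflect_mem_inversions_iff {w : SignedPerm n} {a b : Pt n} (hab : a < b) :
    reflect a b ∈ inversions w ↔ (a, b) ∈ invPairs w :=
  (and_iff_right (isReflection_iff.mpr ⟨a, b, hab, rfl⟩)).trans (coxLength_reflect_mul_lt_iff hab)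

theorem weak_le_iff {u w : SignedPerm n} : u ≤ w ↔ invPairs u ⊆ invPairs w := by
  change inversions u ⊆ inversions w ↔ _
  constructor
  · rintro h ⟨a, b⟩ hab
    exact (reflect_mem_inversions_iff hab.1).mp (h ((reflect_mem_inversions_iff hab.1).mpr hab))
  · rintro h t ht
    obtain ⟨a, b, hab, rfl⟩ := isReflection_iff.mp ht.1
    exact (reflect_mem_inversions_iff hab).mpr (h ((reflect_mem_inversions_iff hab).mp ht))

theorem weak_le_antisymm {u w : SignedPerm n} (h : u ≤ w) (h' : w ≤ u) : u = w :=
  invPairs_injective ((weak_le_iff.mp h).antisymm (weak_le_iff.mp h'))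

/-! ### Arcs and arc diagrams -/

namespace Arc

theorem neg_lower (α : Arc n) : (-α).lower = -α.upper := rfl

theorem neg_upper (α : Arc n) : (-α).upper = -α.lower := rfl

/-- The endpoints of an arc, the lower one first. -/
def ends (α : Arc n) : Pt n × Pt n := (α.lower, α.upper)

/-- The points that precede the descent of `α` in the word of a permutation with arc `α`, among
those in the range of heights of `α`: its upper endpoint and the points to its left. -/
def before (α : Arc n) : Set (Pt n) := insert α.upper α.left

/-- The counterpart of `Arc.before` for the points that follow the descent. -/
def after (α : Arc n) : Set (Pt n) := insert α.lower α.right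

/-- The pairs of values inverted by each permutation that has the arc `α`. -/
def invPairs (α : Arc n) : Set (Pt n × Pt n) := {c | c.1 < c.2 ∧ c.1 ∈ α.after ∧ c.2 ∈ α.before}

theorem lower_mem_after (α : Arc n) : α.lower ∈ α.after := Set.mem_insert _ _

theorem upper_mem_before (α : Arc n) : α.upper ∈ α.before := Set.mem_insert _ _

theorem after_subset_Ico (α : Arc n) : α.after ⊆ Set.Ico α.lower α.upper :=
  Set.insert_subset ⟨le_rfl, α.lower_lt_upper⟩ (α.right_subset.trans Set.Ioo_subset_Ico_self)

theorem before_eq_sdiff (α : Arc n) : α.before = Set.Icc α.lower α.upper \ α.after := by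
  have hlt := α.lower_lt_upper
  have hright := fun h => (α.right_subset h).2.false
  ext x
  simp only [before, left, after, Set.mem_insert_iff, Set.mem_sdiff, Set.mem_Ioo, Set.mem_Icc]
  grind

theorem right_eq_sdiff (α : Arc n) : α.right = α.after \ {α.lower} :=
  (Set.insert_sdiff_self_of_notMem fun h => (α.right_subset h).1.false).symm

theorem ext_after {α β : Arc n} (hl : α.lower = β.lower) (hu : α.upper = β.upper)
    (h : α.after = β.after) : α = β := by
  ext1
  · exact hl
  · exact hu
  · rw [right_eq_sdiff, right_eq_sdiff, hl, h]

theorem mem_neg_after {α : Arc n} {x : Pt n} : x ∈ (-α).after ↔ -x ∈ α.before :=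
  or_congr neg_eq_iff_eq_neg.symm Iff.rfl

theorem mem_neg_before {α : Arc n} {x : Pt n} : x ∈ (-α).before ↔ -x ∈ α.after := by
  have h1 : -α.upper ≤ x ↔ -x ≤ α.upper := by rw [← Pt.neg_le_neg_iff, neg_neg]
  have h2 : x ≤ -α.lower ↔ α.lower ≤ -x := by rw [← Pt.neg_le_neg_iff, neg_neg]
  have hafter := @after_subset_Ico n α (-x)
  rw [before_eq_sdiff, Set.mem_sdiff, mem_neg_after, before_eq_sdiff]
  simp only [neg_lower, neg_upper, Set.mem_Icc, Set.mem_sdiff, Set.mem_Ico] at *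
  grind

instance instInvolutiveNeg : InvolutiveNeg (Arc n) where
  neg_neg α := ext_after (neg_neg _) (neg_neg _) <| by
    ext x
    rw [mem_neg_after, mem_neg_before, neg_neg]

theorem neg_mem_invPairs {α : Arc n} {a b : Pt n} :
    (-b, -a) ∈ (-α).invPairs ↔ (a, b) ∈ α.invPairs := by
  simp only [invPairs, Set.mem_ofPred_eq, Pt.neg_lt_neg_iff, mem_neg_after, mem_neg_before, neg_neg]
  tauto

end Arc

section Delta

variable {π : SignedPerm n} {α β : Arc n}

theorem mem_delta_iff : α ∈ delta π ↔ pos π α.upper ⋖ pos π α.lower ∧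
    (∀ x ∈ α.before, pos π x ≤ pos π α.upper) ∧ ∀ x ∈ α.after, pos π α.lower ≤ pos π x := by
  constructor
  · rintro ⟨i, i', hcov, hu, hl, hright⟩
    have hi : pos π α.upper = i := by rw [hu, pos_apply]
    have hi' : pos π α.lower = i' := by rw [hl, pos_apply]
    rw [hi, hi']
    refine ⟨hcov, ?_, ?_⟩
    · rintro x (rfl | hx)
      · exact hi.le
      refine not_lt.mp fun hlt => hx.2 ?_
      rw [hright, ← hu, ← hl]
      refine ⟨hx.1.1, hx.1.2, pos π x, (hcov.ge_of_gt hlt).lt_of_ne ?_, apply_pos π x⟩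
      exact hi' ▸ (pos_injective π).ne hx.1.1.ne
    · rintro x (rfl | hx)
      · exact hi'.ge
      rw [hright] at hx
      obtain ⟨-, -, k, hk, rfl⟩ := hx
      exact (pos_apply π k).symm ▸ hk.le
  · rintro ⟨hcov, hbefore, hafter⟩
    refine ⟨_, _, hcov, (apply_pos _ _).symm, (apply_pos _ _).symm, ?_⟩
    ext x
    rw [apply_pos, apply_pos]
    constructor
    · intro hx
      have hx' := α.right_subset hx
      exact ⟨hx'.1, hx'.2, pos π x,
        (hafter x (Or.inr hx)).lt_of_ne ((pos_injective π).ne hx'.1.ne), apply_pos π x⟩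
    · rintro ⟨hlx, hxu, k, hk, rfl⟩
      by_contra hn
      have hle := hbefore _ (Or.inr ⟨⟨hlx, hxu⟩, hn⟩)
      rw [pos_apply] at hle
      exact hle.not_gt (hcov.lt.trans hk)

theorem neg_mem_delta (hα : α ∈ delta π) : -α ∈ delta π := by
  obtain ⟨hcov, hbefore, hafter⟩ := mem_delta_iff.mp hα
  simp only [mem_delta_iff, Arc.neg_upper, Arc.neg_lower, pos_neg, Pt.neg_covBy_neg_iff]
  refine ⟨hcov, fun x hx => ?_, fun x hx => ?_⟩
  · rw [← Pt.neg_le_neg_iff, neg_neg, ← pos_neg]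
    exact hafter _ (Arc.mem_neg_before.mp hx)
  · rw [← Pt.neg_le_neg_iff, neg_neg, ← pos_neg]
    exact hbefore _ (Arc.mem_neg_after.mp hx)

theorem mem_after_iff (hα : α ∈ delta π) {x : Pt n} :
    x ∈ α.after ↔ x ∈ Set.Icc α.lower α.upper ∧ pos π α.lower ≤ pos π x := by
  obtain ⟨hcov, hbefore, hafter⟩ := mem_delta_iff.mp hα
  refine ⟨fun h => ⟨Set.Ico_subset_Icc_self (α.after_subset_Ico h), hafter x h⟩, fun ⟨hx, h⟩ => ?_⟩
  by_contra hn
  exact (hcov.lt.trans_le h).not_ge (hbefore x (α.before_eq_sdiff ▸ ⟨hx, hn⟩))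

theorem mem_before_iff (hα : α ∈ delta π) {x : Pt n} :
    x ∈ α.before ↔ x ∈ Set.Icc α.lower α.upper ∧ pos π x ≤ pos π α.upper := by
  obtain ⟨hcov, hbefore, hafter⟩ := mem_delta_iff.mp hα
  have hle := hbefore x
  rw [Arc.before_eq_sdiff, Set.mem_sdiff] at hle ⊢
  refine ⟨fun h => ⟨h.1, hle h⟩, fun ⟨hx, h⟩ => ⟨hx, fun hn => ?_⟩⟩
  exact (hcov.lt.trans_le (hafter x hn)).not_ge h

theorem mem_arc_invPairs_iff (hα : α ∈ delta π) {a b : Pt n} : (a, b) ∈ α.invPairs ↔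
    (a < b ∧ α.lower ≤ a ∧ b ≤ α.upper) ∧ pos π b ≤ pos π α.upper ∧ pos π α.lower ≤ pos π a := by
  have ha := fun (h : a < b) (hb : b ≤ α.upper) => h.le.trans hb
  have hb := fun (h : a < b) (ha : α.lower ≤ a) => ha.trans h.le
  simp only [Arc.invPairs, Set.mem_ofPred_eq, mem_after_iff hα, mem_before_iff hα, Set.mem_Icc]
  tauto

theorem arc_invPairs_subset (hα : α ∈ delta π) : α.invPairs ⊆ invPairs π := fun _ h =>
  have hpos := ((mem_arc_invPairs_iff hα).mp h).2
  ⟨h.1, hpos.1.trans_lt ((mem_delta_iff.mp hα).1.lt.trans_le hpos.2)⟩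

theorem ends_mem_arc_invPairs (α : Arc n) : α.ends ∈ α.invPairs :=
  ⟨α.lower_lt_upper, α.lower_mem_after, α.upper_mem_before⟩

theorem arc_invPairs_subset_of_le {y : SignedPerm n} (hy : y ≤ π) (hα : α ∈ delta π)
    (h : α.ends ∈ invPairs y) : α.invPairs ⊆ invPairs y := by
  have le_of_pos_le {c d : Pt n} (hcd : c ≤ d) (h : pos π c ≤ pos π d) : pos y c ≤ pos y d := by
    rcases hcd.eq_or_lt with rfl | hlt
    · exact le_rfl
    · exact (pos_lt_pos_of_notMem_invPairs hlt fun hn => (weak_le_iff.mp hy hn).2.not_ge h).le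
  rintro ⟨a, b⟩ hab
  obtain ⟨⟨-, ha, hb⟩, hposb, hposa⟩ := (mem_arc_invPairs_iff hα).mp hab
  exact ⟨hab.1, (le_of_pos_le hb hposb).trans_lt (h.2.trans_le (le_of_pos_le ha hposa))⟩

theorem eq_of_upper_eq (hα : α ∈ delta π) (hβ : β ∈ delta π) (h : α.upper = β.upper) : α = β := by
  have hl : α.lower = β.lower := pos_injective π
    ((mem_delta_iff.mp hα).1.unique_right (h ▸ (mem_delta_iff.mp hβ).1))
  refine Arc.ext_after hl h (Set.ext fun x => ?_)
  rw [mem_after_iff hα, mem_after_iff hβ, hl, h]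

theorem eq_of_lower_eq (hα : α ∈ delta π) (hβ : β ∈ delta π) (h : α.lower = β.lower) : α = β :=
  eq_of_upper_eq hα hβ <| pos_injective π <|
    (mem_delta_iff.mp hα).1.unique_left (h ▸ (mem_delta_iff.mp hβ).1)

theorem not_rightAt_of_pos_lt (hα : α ∈ delta π) (hβ : β ∈ delta π)
    (h : pos π α.upper < pos π β.upper) (x : Pt n) : ¬ α.RightAt β x := by
  rintro ⟨hxα, hxβ, hends⟩
  have hα' := mem_delta_iff.mp hα
  have hβ' := mem_delta_iff.mp hβ
  have hle_lower : pos π x ≤ pos π α.lower := by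
    rcases hxα with hx | rfl | rfl
    · exact (hα'.2.1 x (Or.inr hx)).trans hα'.1.le
    · exact le_rfl
    · exact hα'.1.le
  have hupper_le : pos π β.upper ≤ pos π x := by
    rcases hxβ with hx | rfl | rfl
    · exact hβ'.1.le.trans (hβ'.2.2 x (Or.inr hx))
    · exact hβ'.1.le
    · exact le_rfl
  have hlower_le_upper : pos π α.lower ≤ pos π β.upper := hα'.1.ge_of_gt h
  exact hends ⟨Or.inl (pos_injective π (hle_lower.antisymm (hlower_le_upper.trans hupper_le))),
    Or.inr (pos_injective π ((hle_lower.trans hlower_le_upper).antisymm hupper_le))⟩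

theorem compatible_of_mem_delta (hα : α ∈ delta π) (hβ : β ∈ delta π) (hne : α ≠ β) :
    α.Compatible β := by
  refine ⟨fun h => hne (eq_of_upper_eq hα hβ h), fun h => hne (eq_of_lower_eq hα hβ h), ?_⟩
  rintro ⟨⟨x, hx⟩, y, hy⟩
  rcases lt_trichotomy (pos π α.upper) (pos π β.upper) with h | h | h
  · exact not_rightAt_of_pos_lt hα hβ h x hx
  · exact hne (eq_of_upper_eq hα hβ (pos_injective π h))
  · exact not_rightAt_of_pos_lt hβ hα h y hy

theorem exists_mem_delta {p q : Pt n} (hpq : p < q) (h : pos π q ⋖ pos π p) :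
    ∃ α ∈ delta π, α.lower = p ∧ α.upper = q :=
  ⟨⟨p, q, {x | p < x ∧ x < q ∧ ∃ k, pos π p < k ∧ π.1 k = x}, hpq, fun _ hx => ⟨hx.1, hx.2.1⟩⟩,
    ⟨pos π q, pos π p, h, by simp, by simp, by simp⟩, rfl, rfl⟩

end Delta

theorem exists_descent_of_mem_invPairs {π : SignedPerm n} {a b : Pt n} (hab : (a, b) ∈ invPairs π)
    (hbtw : ∀ c, (a, c) ∈ invPairs π → (c, b) ∉ invPairs π) :
    ∃ i i', i ⋖ i' ∧ (pos π b ≤ i ∧ b ≤ π.1 i) ∧ i' ≤ pos π a ∧ π.1 i' ≤ a := by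
  classical
  let _ : Fintype (Pt n) := Fintype.ofFinite _
  let _ : LocallyFiniteOrder (Pt n) := Fintype.toLocallyFiniteOrder
  -- The descent starts at the last position before that of `a` whose value is at least `b`.
  obtain ⟨i, ⟨hbi, hia, hi⟩, hmax⟩ := Set.Finite.exists_maximal
    (s := {i | pos π b ≤ i ∧ i < pos π a ∧ b ≤ π.1 i}) (Set.toFinite _)
    ⟨pos π b, le_rfl, hab.2, (apply_pos π b).ge⟩
  obtain ⟨i', hcov, hi'a⟩ := exists_covBy_le_of_lt hia
  refine ⟨i, i', hcov, ⟨hbi, hi⟩, hi'a, ?_⟩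
  rcases hi'a.eq_or_lt with rfl | hlt
  · exact (apply_pos π a).le
  have hi'b : π.1 i' < b := not_le.mp fun hb =>
    hcov.lt.not_ge (hmax ⟨hbi.trans hcov.le, hlt, hb⟩ hcov.le)
  refine not_lt.mp fun ha => hbtw (π.1 i') ⟨ha, ?_⟩ ⟨hi'b, ?_⟩
  · simpa only [pos_apply] using hlt
  · simpa only [pos_apply] using hbi.trans_lt hcov.lt

theorem exists_mem_arc_invPairs {π : SignedPerm n} {a b : Pt n} (hab : (a, b) ∈ invPairs π)
    (hbtw : ∀ c, (a, c) ∈ invPairs π → (c, b) ∉ invPairs π) :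
    ∃ α ∈ delta π, (a, b) ∈ α.invPairs := by
  obtain ⟨i, i', hcov, ⟨hbi, hi⟩, hi'a, hi'⟩ := exists_descent_of_mem_invPairs hab hbtw
  obtain ⟨α, hα, hl, hu⟩ := exists_mem_delta (hi'.trans_lt (hab.1.trans_le hi))
    (show pos π (π.1 i) ⋖ pos π (π.1 i') by rwa [pos_apply, pos_apply])
  refine ⟨α, hα, (mem_arc_invPairs_iff hα).mpr ?_⟩
  rw [hl, hu, pos_apply, pos_apply]
  exact ⟨⟨hab.1, hi', hi⟩, hbi, hi'a⟩

theorem le_of_arc_invPairs_subset {π u : SignedPerm n}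
    (hu : ∀ α ∈ delta π, α.invPairs ⊆ invPairs u) : π ≤ u := by
  refine weak_le_iff.mpr ?_
  rintro ⟨a, b⟩ hab
  induction hd : (b.1 - a.1).toNat using Nat.strong_induction_on generalizing a b with
  | _ d ih =>
  by_cases hbtw : ∃ c, (a, c) ∈ invPairs π ∧ (c, b) ∈ invPairs π
  · obtain ⟨c, hac, hcb⟩ := hbtw
    have hac' : a.1 < c.1 := hac.1
    have hcb' : c.1 < b.1 := hcb.1
    exact invPairs_trans (ih _ (by omega) a c hac rfl) (ih _ (by omega) c b hcb rfl)
  · obtain ⟨α, hα, h⟩ := exists_mem_arc_invPairs hab (by simpa using hbtw)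
    exact hu α hα h

theorem delta_injective : Function.Injective (delta (n := n)) := fun _ _ h =>
  weak_le_antisymm (le_of_arc_invPairs_subset fun _ hα => arc_invPairs_subset (h ▸ hα))
    (le_of_arc_invPairs_subset fun _ hα => arc_invPairs_subset (h ▸ hα))

/-! ### Join-irreducible elements and canonical join representations -/

section CanonicalJoinRep

variable {π j : SignedPerm n} {α β : Arc n}

theorem ends_mem_invPairs (hα : α ∈ delta π) : α.ends ∈ invPairs π :=
  arc_invPairs_subset hα (ends_mem_arc_invPairs α)

theorem eq_of_ends_mem_arc_invPairs (hα : α ∈ delta π) (hβ : β ∈ delta π)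
    (h : α.ends ∈ β.invPairs) : α = β := by
  obtain ⟨-, hupper, hlower⟩ := (mem_arc_invPairs_iff hβ).mp h
  have hge : pos π β.upper ≤ pos π α.upper := not_lt.mp fun hlt =>
    ((mem_delta_iff.mp hβ).1.lt.trans_le hlower).not_ge ((mem_delta_iff.mp hα).1.ge_of_gt hlt)
  exact eq_of_upper_eq hα hβ (pos_injective π (hupper.antisymm hge))

/-- Undoing the descent of the arc `α` of `π`. -/
theorem exists_invPairs_eq_sdiff (hα : α ∈ delta π) :
    ∃ u : SignedPerm n, invPairs u = invPairs π \ {α.ends, (-α).ends} := by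
  refine ⟨π * reflect (pos π α.upper) (pos π α.lower), ?_⟩
  rw [invPairs_mul_reflect (mem_delta_iff.mp hα).1, apply_pos, apply_pos]
  · rfl
  · simpa only [apply_pos] using α.lower_lt_upper

theorem exists_lt_forall_le_of_ends_notMem (hα : α ∈ delta π) :
    ∃ u < π, ∀ y ≤ π, α.ends ∉ invPairs y → y ≤ u := by
  obtain ⟨u, hu⟩ := exists_invPairs_eq_sdiff hα
  have hends : α.ends ∉ invPairs u := fun h => (hu ▸ h).2 (Or.inl rfl)
  refine ⟨u, lt_of_le_not_ge (weak_le_iff.mpr (hu ▸ Set.sdiff_subset)) fun h =>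
    hends (weak_le_iff.mp h (ends_mem_invPairs hα)), fun y hy hn => weak_le_iff.mpr ?_⟩
  rw [hu]
  refine Set.subset_sdiff.mpr ⟨weak_le_iff.mp hy, Set.disjoint_right.mpr ?_⟩
  rintro c (rfl | rfl)
  · exact hn
  · exact fun h => hn (neg_mem_invPairs.mp h)

theorem le_iff_of_delta_eq {u : SignedPerm n} (hj : delta j = {α, -α}) :
    j ≤ u ↔ α.invPairs ⊆ invPairs u := by
  constructor
  · intro h
    exact (arc_invPairs_subset (hj ▸ Or.inl rfl)).trans (weak_le_iff.mp h)
  · intro h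
    refine le_of_arc_invPairs_subset fun β hβ => ?_
    rw [hj] at hβ
    rcases hβ with rfl | rfl
    · exact h
    · rintro ⟨a, b⟩ hab
      refine neg_mem_invPairs.mp (h ?_)
      simpa only [neg_neg] using Arc.neg_mem_invPairs.mpr hab

theorem le_of_ends_mem_invPairs {y : SignedPerm n} (hj : delta j = {α, -α}) (hα : α ∈ delta π)
    (hy : y ≤ π) (h : α.ends ∈ invPairs y) : j ≤ y :=
  (le_iff_of_delta_eq hj).mpr (arc_invPairs_subset_of_le hy hα h)

theorem isJoinIrreducible_of_delta_eq (hj : delta j = {α, -α}) : IsJoinIrreducible j := by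
  have hα : α ∈ delta j := hj ▸ Or.inl rfl
  obtain ⟨u, hu, hmax⟩ := exists_lt_forall_le_of_ends_notMem hα
  have hle : ∀ k < j, k ≤ u := fun k hk =>
    hmax k hk.le fun h => hk.not_ge (le_of_ends_mem_invPairs hj hα hk.le h)
  refine ⟨u, ⟨hu, fun k huk hkj => huk.not_ge (hle k hkj)⟩, fun k hk => ?_⟩
  refine weak_le_antisymm (hle k hk.lt) (by_contra fun hn => ?_)
  exact hk.2 (lt_of_le_not_ge (hle k hk.lt) hn) hu

theorem mem_delta_of_ends_mem_invPairs (hj : delta j ⊆ delta π) (hα : α ∈ delta π)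
    (h : α.ends ∈ invPairs j) : α ∈ delta j := by
  by_contra hn
  obtain ⟨u, hu⟩ := exists_invPairs_eq_sdiff hα
  have hju : j ≤ u := by
    refine le_of_arc_invPairs_subset fun β hβ => ?_
    rw [hu]
    refine Set.subset_sdiff.mpr ⟨arc_invPairs_subset (hj hβ), Set.disjoint_right.mpr ?_⟩
    rintro c (rfl | rfl) hc
    · exact hn (eq_of_ends_mem_arc_invPairs hα (hj hβ) hc ▸ hβ)
    · have hβα := eq_of_ends_mem_arc_invPairs (neg_mem_delta hα) (hj hβ) hc
      exact hn (neg_neg α ▸ neg_mem_delta (hβα ▸ hβ))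
  exact (hu ▸ weak_le_iff.mp hju h).2 (Or.inl rfl)

theorem pair_neg_eq_of_mem (h : α ∈ ({β, -β} : Set (Arc n))) :
    ({α, -α} : Set (Arc n)) = {β, -β} := by
  rcases h with rfl | rfl
  · rfl
  · rw [neg_neg, Set.pair_comm]

theorem pair_neg_subset_delta (hα : α ∈ delta π) : {α, -α} ⊆ delta π :=
  Set.insert_subset hα (Set.singleton_subset_iff.mpr (neg_mem_delta hα))

theorem isCanonicalJoinRep_of_delta {X : Set (SignedPerm n)}
    (hX : ∀ j ∈ X, ∃ α ∈ delta π, delta j = {α, -α})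
    (hX' : ∀ α ∈ delta π, ∃ j ∈ X, delta j = {α, -α}) : IsCanonicalJoinRep π X where
  antichain := by
    intro j hj k hk hne hle
    obtain ⟨α, hα, hjα⟩ := hX j hj
    obtain ⟨β, hβ, hkβ⟩ := hX k hk
    have hαk : α ∈ delta k := mem_delta_of_ends_mem_invPairs (hkβ ▸ pair_neg_subset_delta hβ) hα
      (weak_le_iff.mp hle (ends_mem_invPairs (hjα ▸ Or.inl rfl)))
    exact hne (delta_injective (by rw [hjα, hkβ, pair_neg_eq_of_mem (hkβ ▸ hαk)]))
  isLUB := by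
    constructor
    · intro j hj
      obtain ⟨α, hα, hjα⟩ := hX j hj
      exact le_of_ends_mem_invPairs hjα hα le_rfl (ends_mem_invPairs hα)
    · intro u hu
      refine le_of_arc_invPairs_subset fun α hα => ?_
      obtain ⟨j, hj, hjα⟩ := hX' α hα
      exact (le_iff_of_delta_eq hjα).mp (hu hj)
  minimal := by
    rintro X' hX' k ⟨j, hj, hkj⟩
    obtain ⟨α, hα, hjα⟩ := hX j hj
    obtain ⟨u, hu, hmax⟩ := exists_lt_forall_le_of_ends_notMem hα
    by_contra hk
    refine hu.not_ge (hX'.2 fun y hy => hmax y (hX'.1 hy) fun h => hk ?_)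
    exact ⟨y, hy, hkj.trans (le_of_ends_mem_invPairs hjα hα (hX'.1 hy) h)⟩

end CanonicalJoinRep

/-! ### Words -/

theorem mem_increasing {S : Set (Pt n)} {x : Pt n} : x ∈ increasing S ↔ x ∈ S := by
  rw [increasing, Finset.mem_sort, Set.Finite.mem_toFinset]

theorem increasing_pairwise (S : Set (Pt n)) : (increasing S).Pairwise (· < ·) :=
  (Finset.sortedLT_sort _).pairwise

theorem eq_of_pairwise_lt {α β : Type*} [Preorder β] (f : α → β) {l l' : List α}
    (hl : l.Pairwise fun x y => f x < f y) (hl' : l'.Pairwise fun x y => f x < f y)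
    (h : ∀ x, x ∈ l ↔ x ∈ l') : l = l' := by
  have nodup {m : List α} (hm : m.Pairwise fun x y => f x < f y) : m.Nodup :=
    hm.imp fun hab hne => hab.ne (congrArg f hne)
  exact List.Perm.eq_of_pairwise (fun a b _ _ hab hba => absurd hab hba.asymm) hl hl'
    ((List.perm_ext_iff_of_nodup (nodup hl) (nodup hl')).mpr h)

theorem increasing_union {A B : Set (Pt n)} (h : ∀ a ∈ A, ∀ b ∈ B, a < b) :
    increasing (A ∪ B) = increasing A ++ increasing B := by
  refine eq_of_pairwise_lt id (increasing_pairwise _) ?_ fun x => ?_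
  · refine List.pairwise_append.mpr ⟨increasing_pairwise _, increasing_pairwise _, ?_⟩
    exact fun a ha b hb => h a (mem_increasing.mp ha) b (mem_increasing.mp hb)
  · simp only [List.mem_append, mem_increasing, Set.mem_union]

theorem increasing_singleton (a : Pt n) : increasing {a} = [a] :=
  eq_of_pairwise_lt id (increasing_pairwise _) (List.pairwise_singleton _ _) fun x => by
    rw [mem_increasing, List.mem_singleton, Set.mem_singleton_iff]

theorem increasing_empty : increasing (∅ : Set (Pt n)) = [] :=
  List.eq_nil_iff_forall_not_mem.mpr fun _ hx => (mem_increasing.mp hx).elim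

theorem oneLine_injective : Function.Injective (oneLine (n := n)) := by
  intro u w h
  have eq_of_pos {i : Pt n} (hi : 0 < i.1) : u.1 i = w.1 i :=
    List.map_inj_left.mp h i (mem_increasing.mpr hi)
  refine Subtype.ext (Equiv.ext fun i => ?_)
  rcases i.2.1.lt_or_gt with hi | hi
  · have := eq_of_pos (i := -i) (neg_pos.mpr hi)
    rwa [apply_neg, apply_neg, neg_inj] at this
  · exact eq_of_pos hi

theorem oneLine_pairwise (π : SignedPerm n) :
    (oneLine π).Pairwise fun x y => pos π x < pos π y :=
  List.pairwise_map.mpr <| (increasing_pairwise _).imp fun hab => by rwa [pos_apply, pos_apply]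

theorem mem_oneLine {π : SignedPerm n} {x : Pt n} :
    x ∈ oneLine π ↔ pos π (-x) < pos π x := by
  have hpos : pos π (-x) < pos π x ↔ 0 < (pos π x).1 := by
    rw [pos_neg]
    exact neg_lt_self_iff (α := ℤ)
  rw [hpos, oneLine, List.mem_map]
  constructor
  · rintro ⟨i, hi, rfl⟩
    rw [pos_apply]
    exact mem_increasing.mp hi
  · exact fun hx => ⟨pos π x, mem_increasing.mpr hx, apply_pos π x⟩

/-! ### Signed permutations with two increasing runs on the positive positions -/

theorem exists_perm_strictMono_comp {α β : Type*} [Finite α] [LinearOrder α] [LinearOrder β]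
    {f : α → β} (hf : Function.Injective f) : ∃ σ : Equiv.Perm α, StrictMono (f ∘ σ) := by
  let _ : Fintype α := Fintype.ofFinite α
  let e : Fin (Fintype.card α) ≃o α := Fintype.orderIsoFinOfCardEq α rfl
  let σ : Equiv.Perm α := e.toEquiv.symm.trans ((Tuple.sort (f ∘ e)).trans e.toEquiv)
  have hmono : Monotone (f ∘ σ) := (Tuple.monotone_sort (f ∘ e)).comp e.symm.monotone
  exact ⟨σ, hmono.strictMono_of_injective (hf.comp σ.injective)⟩

theorem exists_signedPerm_strictMono_comp {β : Type*} [LinearOrder β] {f : Pt n → β}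
    (hf : Function.Injective f) (hneg : ∀ x y, f x < f y → f (-y) < f (-x)) :
    ∃ π : SignedPerm n, StrictMono (f ∘ π.1) := by
  obtain ⟨σ, hσ⟩ := exists_perm_strictMono_comp hf
  have hmono : StrictMono (σ⁻¹ * (Equiv.neg (Pt n) * σ * Equiv.neg (Pt n))) := by
    intro x y hxy
    rw [← hσ.lt_iff_lt]
    simpa using hneg _ _ (hσ (neg_lt_neg_pt hxy))
  have hσ_neg := inv_mul_eq_one.mp (perm_eq_one_of_strictMono hmono)
  refine ⟨⟨σ, fun x => ?_⟩, hσ⟩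
  simpa using DFunLike.congr_fun hσ_neg (-x)

/-- The increasing run that contains the value `x` in `IsGrassmannian π S`, numbered `-1`, `0`,
`1` from left to right. -/
noncomputable def runIndex (S : Set (Pt n)) (x : Pt n) : ℤ := S.indicator 1 x - S.indicator 1 (-x)

/-- The positive values of the middle run in `IsGrassmannian π S`. -/
def midRun (S : Set (Pt n)) : Set (Pt n) := {x | 0 < x.1 ∧ x ∉ S ∧ -x ∉ S}

/-- The long one-line notation of `π` consists of three increasing runs, with the values in `-S`,
in neither `-S` nor `S`, and in `S`. It is meant for sets `S` that are disjoint from `-S`. -/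
def IsGrassmannian (π : SignedPerm n) (S : Set (Pt n)) : Prop :=
  StrictMono fun i => toLex (runIndex S (π.1 i), π.1 i)

theorem runIndex_neg (S : Set (Pt n)) (x : Pt n) : runIndex S (-x) = -runIndex S x := by
  rw [runIndex, runIndex, neg_neg, neg_sub]

theorem runIndex_of_mem {S : Set (Pt n)} {x : Pt n} (hx : x ∈ S) (hnx : -x ∉ S) :
    runIndex S x = 1 := by
  rw [runIndex, Set.indicator_of_mem hx, Set.indicator_of_notMem hnx, Pi.one_apply, sub_zero]

theorem runIndex_of_neg_mem {S : Set (Pt n)} {x : Pt n} (hx : x ∉ S) (hnx : -x ∈ S) :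
    runIndex S x = -1 := by
  rw [runIndex, Set.indicator_of_notMem hx, Set.indicator_of_mem hnx, Pi.one_apply, zero_sub]

theorem runIndex_of_notMem {S : Set (Pt n)} {x : Pt n} (hx : x ∉ S) (hnx : -x ∉ S) :
    runIndex S x = 0 := by
  rw [runIndex, Set.indicator_of_notMem hx, Set.indicator_of_notMem hnx, sub_zero]

theorem exists_isGrassmannian (S : Set (Pt n)) : ∃ π : SignedPerm n, IsGrassmannian π S := by
  refine exists_signedPerm_strictMono_comp (f := fun x => toLex (runIndex S x, x))
    (fun x y h => (Prod.ext_iff.mp (toLex_inj.mp h)).2) fun x y h => ?_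
  rw [Prod.Lex.toLex_lt_toLex] at h ⊢
  rw [runIndex_neg, runIndex_neg, neg_lt_neg_iff, neg_inj, Pt.neg_lt_neg_iff]
  exact h.imp_right (And.imp_left Eq.symm)

namespace IsGrassmannian

variable {π : SignedPerm n} {S : Set (Pt n)} {x y : Pt n}

theorem pos_lt_pos_iff (h : IsGrassmannian π S) : pos π x < pos π y ↔
    runIndex S x < runIndex S y ∨ runIndex S x = runIndex S y ∧ x < y := by
  rw [← h.lt_iff_lt, Prod.Lex.toLex_lt_toLex, apply_pos, apply_pos]

theorem pos_le_pos (h : IsGrassmannian π S) (hindex : runIndex S x = runIndex S y) (hxy : x ≤ y) :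
    pos π x ≤ pos π y := by
  rw [← not_lt, h.pos_lt_pos_iff, hindex]
  exact fun hlt => hlt.elim (lt_irrefl _) fun hlt => hlt.2.not_ge hxy

theorem increasing_pairwise (h : IsGrassmannian π S) {T : Set (Pt n)} {k : ℤ}
    (hT : ∀ x ∈ T, runIndex S x = k) : (increasing T).Pairwise fun x y => pos π x < pos π y :=
  (TypeB.increasing_pairwise T).imp_of_mem fun ha hb hab => h.pos_lt_pos_iff.mpr <|
    Or.inr ⟨(hT _ (mem_increasing.mp ha)).trans (hT _ (mem_increasing.mp hb)).symm, hab⟩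

theorem pos_lt_pos_of_notMem_of_mem (h : IsGrassmannian π S) (hS : ∀ x ∈ S, -x ∉ S)
    (hx : x ∉ S) (hy : y ∈ S) : pos π x < pos π y := by
  refine h.pos_lt_pos_iff.mpr (Or.inl ?_)
  rw [runIndex_of_mem hy (hS y hy)]
  by_cases hnx : -x ∈ S
  · rw [runIndex_of_neg_mem hx hnx]
    decide
  · rw [runIndex_of_notMem hx hnx]
    decide

theorem oneLine_eq (h : IsGrassmannian π S) (hS : ∀ x ∈ S, -x ∉ S) :
    oneLine π = increasing (midRun S) ++ increasing S := by
  refine eq_of_pairwise_lt (pos π) (oneLine_pairwise π) ?_ fun x => ?_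
  · refine List.pairwise_append.mpr
      ⟨h.increasing_pairwise fun x hx => runIndex_of_notMem hx.2.1 hx.2.2,
        h.increasing_pairwise fun x hx => runIndex_of_mem hx (hS x hx), fun a ha b hb => ?_⟩
    exact h.pos_lt_pos_of_notMem_of_mem hS (mem_increasing.mp ha).2.1 (mem_increasing.mp hb)
  · rw [mem_oneLine, List.mem_append, mem_increasing, mem_increasing]
    by_cases hx : x ∈ S
    · exact iff_of_true (h.pos_lt_pos_of_notMem_of_mem hS (hS x hx) hx) (Or.inr hx)
    by_cases hnx : -x ∈ S
    · have := h.pos_lt_pos_of_notMem_of_mem hS hx hnx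
      exact iff_of_false this.not_gt (not_or.mpr ⟨fun hmid => hmid.2.2 hnx, hx⟩)
    · rw [h.pos_lt_pos_iff, runIndex_neg, runIndex_of_notMem hx hnx, neg_zero]
      have hneg : -x < x ↔ 0 < x.1 := neg_lt_self_iff (α := ℤ)
      simp [midRun, hx, hnx, hneg]

theorem mem_delta (h : IsGrassmannian π S) (hS : ∀ x ∈ S, -x ∉ S) {α : Arc n}
    (hafter : α.after ⊆ S) (hbefore : Disjoint α.before S) (hlower : ∀ x ∈ S, α.lower ≤ x)
    (hupper : ∀ x ∉ S, pos π x ≤ pos π α.upper) : α ∈ delta π := by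
  have hlower_mem : α.lower ∈ S := hafter α.lower_mem_after
  have hupper_mem : α.upper ∉ S := Set.disjoint_left.mp hbefore α.upper_mem_before
  have hlower_le : ∀ x ∈ S, pos π α.lower ≤ pos π x := fun x hx => h.pos_le_pos
    (by rw [runIndex_of_mem hx (hS x hx), runIndex_of_mem hlower_mem (hS _ hlower_mem)])
    (hlower x hx)
  refine mem_delta_iff.mpr ⟨⟨h.pos_lt_pos_of_notMem_of_mem hS hupper_mem hlower_mem,
    fun i hi hi' => ?_⟩, fun x hx => hupper x (Set.disjoint_left.mp hbefore hx),
    fun x hx => hlower_le x (hafter hx)⟩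
  rw [← pos_apply π i] at hi hi'
  by_cases hmem : π.1 i ∈ S
  · exact (hlower_le _ hmem).not_gt hi'
  · exact (hupper _ hmem).not_gt hi

theorem eq_of_mem_delta (h : IsGrassmannian π S) (hS : ∀ x ∈ S, -x ∉ S) {α β : Arc n}
    (hα : α ∈ delta π) (hαl : α.lower ∈ S) (hαu : α.upper ∉ S) (hβ : β ∈ delta π)
    (hβl : β.lower ∈ S) (hβu : β.upper ∉ S) : α = β := by
  have hα' := (mem_delta_iff.mp hα).1.le_of_lt (h.pos_lt_pos_of_notMem_of_mem hS hβu hαl)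
  have hβ' := (mem_delta_iff.mp hβ).1.le_of_lt (h.pos_lt_pos_of_notMem_of_mem hS hαu hβl)
  exact eq_of_upper_eq hα hβ (pos_injective π (hβ'.antisymm hα'))

theorem lower_mem_or_neg_upper_mem (h : IsGrassmannian π S) {β : Arc n} (hβ : β ∈ delta π) :
    (β.lower ∈ S ∧ β.upper ∉ S) ∨ (-β.upper ∈ S ∧ -β.lower ∉ S) := by
  have hdesc := h.pos_lt_pos_iff.mp (mem_delta_iff.mp hβ).1.lt
  have hlt := β.lower_lt_upper.not_gt
  by_cases hl : β.lower ∈ S <;> by_cases hu : β.upper ∈ S <;>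
    by_cases hnl : -β.lower ∈ S <;> by_cases hnu : -β.upper ∈ S <;>
    simp_all [runIndex]

theorem delta_eq (h : IsGrassmannian π S) (hS : ∀ x ∈ S, -x ∉ S) {α : Arc n}
    (hα : α ∈ delta π) (hlower : α.lower ∈ S) (hupper : α.upper ∉ S) : delta π = {α, -α} := by
  refine (pair_neg_subset_delta hα).antisymm' fun β hβ => ?_
  rcases h.lower_mem_or_neg_upper_mem hβ with ⟨hl, hu⟩ | ⟨hl, hu⟩
  · exact Or.inl (h.eq_of_mem_delta hS hβ hl hu hα hlower hupper)
  · exact Or.inr (neg_eq_iff_eq_neg.mp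
      (h.eq_of_mem_delta hS (neg_mem_delta hβ) hl hu hα hlower hupper))

end IsGrassmannian

/-! ### The last increasing run of the join-irreducible element of an arc -/

namespace Arc

variable {α : Arc n} {x : Pt n}

/-- The set of values of the last increasing run of the join-irreducible element written in terms
of `α`. -/
def lastRun (α : Arc n) : Set (Pt n) := α.after ∪ {x | α.upper < x ∧ -x ∉ α.after}

/-- The condition on `α` under which `α` and `-α` are the only arcs of the permutations with
`IsGrassmannian π α.lastRun`. -/
structure Admissible (α : Arc n) : Prop where
  upper_pos : 0 < α.upper.1
  neg_notMem_after : ∀ x ∈ α.after, -x ∉ α.after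
  symmetric_or_neg_upper_notMem_after : -α = α ∨ -α.upper ∉ α.after

theorem lower_le_of_mem_lastRun (hx : x ∈ α.lastRun) : α.lower ≤ x :=
  hx.elim (fun h => (α.after_subset_Ico h).1) fun h => (α.lower_lt_upper.trans h.1).le

theorem disjoint_before_lastRun (α : Arc n) : Disjoint α.before α.lastRun := by
  rw [before_eq_sdiff, Set.disjoint_left]
  rintro x ⟨hx, hafter⟩ (h | h)
  · exact hafter h
  · exact hx.2.not_gt h.1

theorem upper_notMem_lastRun (α : Arc n) : α.upper ∉ α.lastRun :=
  Set.disjoint_left.mp α.disjoint_before_lastRun α.upper_mem_before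

theorem le_upper_of_notMem_lastRun (hx : x ∉ α.lastRun) (hnx : -x ∉ α.lastRun) : x ≤ α.upper :=
  not_lt.mp fun hlt => hx (Or.inr ⟨hlt, fun h => hnx (Or.inl h)⟩)

theorem lower_eq_neg_upper (hα : -α = α) : α.lower = -α.upper := congrArg lower hα.symm

theorem mem_lastRun_or_neg_mem_lastRun (hα : -α = α) (x : Pt n) :
    x ∈ α.lastRun ∨ -x ∈ α.lastRun := by
  by_contra! ⟨hx, hnx⟩
  have hle : x ≤ α.upper := le_upper_of_notMem_lastRun hx hnx
  have hge : α.lower ≤ x := by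
    rw [lower_eq_neg_upper hα, ← Pt.neg_le_neg_iff, neg_neg]
    exact le_upper_of_notMem_lastRun hnx (by rwa [neg_neg])
  have hbefore : x ∈ α.before := α.before_eq_sdiff ▸ ⟨⟨hge, hle⟩, fun h => hx (Or.inl h)⟩
  rw [← hα, mem_neg_before] at hbefore
  exact hnx (Or.inl hbefore)

namespace Admissible

theorem neg_notMem_lastRun (h : α.Admissible) : ∀ x ∈ α.lastRun, -x ∉ α.lastRun := by
  rintro x (hx | hx) (hnx | hnx)
  · exact h.neg_notMem_after x hx hnx
  · exact hnx.2 (by rwa [neg_neg])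
  · exact hx.2 hnx
  · have hpos : 0 < x.1 := h.upper_pos.trans hx.1
    have hneg : 0 < -x.1 := h.upper_pos.trans hnx.1
    lia

theorem neg_upper_notMem_lastRun (h : α.Admissible) (hα : -α ≠ α) : -α.upper ∉ α.lastRun := by
  rintro (hmem | hmem)
  · exact h.symmetric_or_neg_upper_notMem_after.resolve_left hα hmem
  · exact (neg_lt_self h.upper_pos).not_gt hmem.1

theorem pos_le_pos_upper (h : α.Admissible) {π : SignedPerm n} (hπ : IsGrassmannian π α.lastRun)
    (hx : x ∉ α.lastRun) : pos π x ≤ pos π α.upper := by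
  have hupper := α.upper_notMem_lastRun
  by_cases hα : -α = α
  · have hnx : -x ∈ α.lastRun := (mem_lastRun_or_neg_mem_lastRun hα x).resolve_left hx
    have hle : -α.upper ≤ -x := lower_eq_neg_upper hα ▸ lower_le_of_mem_lastRun hnx
    have hnupper : -α.upper ∈ α.lastRun := lower_eq_neg_upper hα ▸ Or.inl α.lower_mem_after
    refine hπ.pos_le_pos ?_ (Pt.neg_le_neg_iff.mp hle)
    rw [runIndex_of_neg_mem hx hnx, runIndex_of_neg_mem hupper hnupper]
  · have hindex : runIndex α.lastRun α.upper = 0 :=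
      runIndex_of_notMem hupper (h.neg_upper_notMem_lastRun hα)
    by_cases hnx : -x ∈ α.lastRun
    · refine (hπ.pos_lt_pos_iff.mpr (Or.inl ?_)).le
      rw [runIndex_of_neg_mem hx hnx, hindex]
      decide
    · refine hπ.pos_le_pos ?_ (le_upper_of_notMem_lastRun hx hnx)
      rw [runIndex_of_notMem hx hnx, hindex]

theorem delta_eq (h : α.Admissible) {π : SignedPerm n} (hπ : IsGrassmannian π α.lastRun) :
    delta π = {α, -α} :=
  have hα : α ∈ delta π := hπ.mem_delta h.neg_notMem_lastRun Set.subset_union_left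
    α.disjoint_before_lastRun (fun _ => lower_le_of_mem_lastRun) fun _ => h.pos_le_pos_upper hπ
  hπ.delta_eq h.neg_notMem_lastRun hα (Or.inl α.lower_mem_after) α.upper_notMem_lastRun

end Admissible

end Arc

/-! ### The one-line notation of the join-irreducible element -/

theorem increasing_insert {a : Pt n} {S : Set (Pt n)} (h : ∀ b ∈ S, a < b) :
    increasing (insert a S) = a :: increasing S := by
  rw [Set.insert_eq, increasing_union fun _ hx => hx ▸ h, increasing_singleton,
    List.singleton_append]

namespace Arc

variable {α : Arc n} {x : Pt n}

theorem mem_left_iff : x ∈ α.left ↔ α.lower < x ∧ x < α.upper ∧ x ∉ α.after := by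
  rw [after, Set.mem_insert_iff, not_or]
  exact ⟨fun h => ⟨h.1.1, h.1.2, h.1.1.ne', h.2⟩, fun h => ⟨⟨h.1, h.2.1⟩, h.2.2.2⟩⟩

theorem mem_lastRun_iff : x ∈ α.lastRun ↔
    x = α.lower ∨ x ∈ α.right ∨ α.upper < x ∧ -x ∉ α.after := or_assoc

theorem increasing_lastRun_of_neg_lower_le (h : -α.lower ≤ α.upper) :
    increasing α.lastRun = α.lower :: (increasing α.right ++ increasing {x | α.upper < x}) := by
  have hlast : α.lastRun = insert α.lower (α.right ∪ {x | α.upper < x}) := by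
    ext x
    have hafter (hx : α.upper < x) : -x ∉ α.after := fun hmem =>
      ((neg_lt_neg_pt hx).trans_le (Pt.neg_le_neg_iff.mp (by rwa [neg_neg]))).not_ge
        (α.after_subset_Ico hmem).1
    rw [mem_lastRun_iff, and_iff_left_of_imp hafter]
    rfl
  rw [hlast, increasing_insert, increasing_union]
  · exact fun a ha b hb => (α.right_subset ha).2.trans hb
  · rintro b (hb | hb)
    exacts [(α.right_subset hb).1, α.lower_lt_upper.trans hb]

theorem increasing_lastRun_of_lt_neg_lower (hupper : 0 < α.upper.1) (h : α.upper < -α.lower) :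
    increasing α.lastRun = α.lower :: (increasing α.right ++
      increasing {x | α.upper < x ∧ x < -α.lower ∧ -x ∈ α.left} ++
      increasing {x | -α.lower < x}) := by
  have hlast : α.lastRun = insert α.lower ((α.right ∪
      {x | α.upper < x ∧ x < -α.lower ∧ -x ∈ α.left}) ∪ {x | -α.lower < x}) := by
    ext x
    have hafter := @after_subset_Ico n α (-x)
    have hlower : -x = α.lower → -x ∈ α.after := fun h => h ▸ α.lower_mem_after
    simp only [mem_lastRun_iff, Set.mem_insert_iff, Set.mem_union, Set.mem_ofPred_eq, mem_left_iff,
      Set.mem_Ico, ← Subtype.coe_lt_coe, ← Subtype.coe_le_coe, Subtype.ext_iff, Pt.coe_neg]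
      at hafter hlower h ⊢
    grind
  rw [hlast, increasing_insert, increasing_union, increasing_union]
  · exact fun a ha b hb => (α.right_subset ha).2.trans hb.1
  · rintro a (ha | ha) b hb
    exacts [((α.right_subset ha).2.trans h).trans hb, ha.2.1.trans hb]
  · rintro b ((hb | hb) | hb)
    exacts [(α.right_subset hb).1, α.lower_lt_upper.trans hb.1,
      (α.lower_lt_upper.trans h).trans hb]

theorem mem_midRun_lastRun_iff (hupper : 0 < α.upper.1) : x ∈ midRun α.lastRun ↔
    0 < x.1 ∧ x ≤ α.upper ∧ x ∉ α.after ∧ -x ∉ α.after := by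
  simp only [midRun, lastRun, Set.mem_ofPred_eq, Set.mem_union, neg_neg, ← Subtype.coe_lt_coe,
    ← Subtype.coe_le_coe, Pt.coe_neg]
  grind

theorem increasing_midRun_of_neg_eq (hα : -α = α) : increasing (midRun α.lastRun) = [] := by
  rw [← increasing_empty]
  congr 1
  refine Set.eq_empty_of_forall_notMem fun x hx => ?_
  exact (mem_lastRun_or_neg_mem_lastRun hα x).elim hx.2.1 hx.2.2

theorem increasing_midRun_of_lower_pos (hlower : 0 < α.lower.1) :
    increasing (midRun α.lastRun) =
      increasing {x | 0 < x.1 ∧ x < α.lower} ++ increasing α.left ++ [α.upper] := by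
  have hupper : 0 < α.upper.1 := hlower.trans α.lower_lt_upper
  have hmid : midRun α.lastRun =
      ({x | 0 < x.1 ∧ x < α.lower} ∪ α.left) ∪ {α.upper} := by
    ext x
    have hafter := @after_subset_Ico n α x
    have hlower_mem : x = α.lower → x ∈ α.after := fun h => h ▸ α.lower_mem_after
    have hlt := α.lower_lt_upper
    have hneg := @after_subset_Ico n α (-x)
    simp only [mem_midRun_lastRun_iff hupper, Set.mem_union, Set.mem_singleton_iff,
      Set.mem_ofPred_eq, mem_left_iff, Set.mem_Ico, ← Subtype.coe_lt_coe, ← Subtype.coe_le_coe,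
      Subtype.ext_iff, Pt.coe_neg] at *
    grind
  rw [hmid, increasing_union, increasing_union, increasing_singleton]
  · exact fun a ha b hb => ha.2.trans hb.1.1
  · rintro a (ha | ha) b rfl
    exacts [ha.2.trans α.lower_lt_upper, ha.1.2]

theorem increasing_midRun_of_neg_lower_lt (hlower : α.lower.1 < 0) (h : -α.lower < α.upper) :
    increasing (midRun α.lastRun) =
      increasing {x | 0 < x.1 ∧ x < -α.lower ∧ x ∈ α.left ∧ -x ∈ α.left} ++
      increasing {x | -α.lower < x ∧ x < α.upper ∧ x ∈ α.left} ++ [α.upper] := by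
  have hupper : 0 < α.upper.1 := (neg_pos.mpr hlower).trans h
  have hmid : midRun α.lastRun =
      ({x | 0 < x.1 ∧ x < -α.lower ∧ x ∈ α.left ∧ -x ∈ α.left} ∪
        {x | -α.lower < x ∧ x < α.upper ∧ x ∈ α.left}) ∪ {α.upper} := by
    ext x
    have hneg := @after_subset_Ico n α (-x)
    have hlower_mem : -x = α.lower → -x ∈ α.after := fun h => h ▸ α.lower_mem_after
    have hafter := @after_subset_Ico n α x
    simp only [mem_midRun_lastRun_iff hupper, Set.mem_union, Set.mem_singleton_iff,
      Set.mem_ofPred_eq, mem_left_iff, Set.mem_Ico, ← Subtype.coe_lt_coe, ← Subtype.coe_le_coe,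
      Subtype.ext_iff, Pt.coe_neg] at *
    grind
  rw [hmid, increasing_union, increasing_union, increasing_singleton]
  · exact fun a ha b hb => ha.2.1.trans hb.1
  · rintro a (ha | ha) b rfl
    exacts [ha.2.1.trans h, ha.2.1]

theorem increasing_midRun_of_lt_neg_lower (hupper : 0 < α.upper.1) (h : α.upper < -α.lower)
    (hnupper : -α.upper ∉ α.after) : increasing (midRun α.lastRun) =
      increasing {x | 0 < x.1 ∧ x < α.upper ∧ x ∈ α.left ∧ -x ∈ α.left} ++ [α.upper] := by
  have hmid : midRun α.lastRun =
      {x | 0 < x.1 ∧ x < α.upper ∧ x ∈ α.left ∧ -x ∈ α.left} ∪ {α.upper} := by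
    ext x
    have hafter := @after_subset_Ico n α x
    have hneg : x = α.upper → -x ∉ α.after := fun h => h ▸ hnupper
    simp only [mem_midRun_lastRun_iff hupper, Set.mem_union, Set.mem_singleton_iff,
      Set.mem_ofPred_eq, mem_left_iff, Set.mem_Ico, ← Subtype.coe_lt_coe, ← Subtype.coe_le_coe,
      Subtype.ext_iff, Pt.coe_neg] at *
    grind
  rw [hmid, increasing_union, increasing_singleton]
  rintro a ha b rfl
  exact ha.2.1

theorem Admissible.jiWord_eq (hα : α.Admissible) (hne : -α = α ∨ α.lower ≠ -α.upper) :
    jiWord α = increasing (midRun α.lastRun) ++ increasing α.lastRun := by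
  have hupper := hα.upper_pos
  rcases hne with hneg | hne
  · have hlower := lower_eq_neg_upper hneg
    rw [increasing_midRun_of_neg_eq hneg,
      increasing_lastRun_of_neg_lower_le (by rw [hlower, neg_neg])]
    simp only [jiWord, if_pos hlower, List.nil_append, List.cons_append]
  have hnupper : -α.upper ∉ α.after := hα.symmetric_or_neg_upper_notMem_after.resolve_left
    fun hneg => hne (lower_eq_neg_upper hneg)
  rcases lt_or_gt_of_ne α.lower.2.1.symm with hlower | hlower
  · have hle : -α.lower ≤ α.upper :=
      (neg_lt_self (a := α.lower.1) hlower).le.trans α.lower_lt_upper.le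
    rw [increasing_midRun_of_lower_pos hlower, increasing_lastRun_of_neg_lower_le hle]
    simp only [jiWord, if_neg hne, if_pos hlower, List.append_assoc, List.cons_append,
      List.nil_append]
  rcases lt_or_gt_of_ne fun h : -α.lower = α.upper => hne (neg_eq_iff_eq_neg.mp h) with h | h
  · rw [increasing_midRun_of_neg_lower_lt hlower h, increasing_lastRun_of_neg_lower_le h.le]
    simp only [jiWord, if_neg hne, if_neg hlower.not_gt, if_pos h, List.append_assoc,
      List.cons_append, List.nil_append]
  · rw [increasing_midRun_of_lt_neg_lower hupper h hnupper,
      increasing_lastRun_of_lt_neg_lower hupper h]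
    simp only [jiWord, if_neg hne, if_neg hlower.not_gt, if_neg h.not_gt, List.append_assoc,
      List.cons_append, List.nil_append]

end Arc

/-! ### Preferred arcs -/

namespace Arc

variable {α β : Arc n} {x : Pt n}

theorem isEndpoint_neg : (-α).IsEndpoint x ↔ α.IsEndpoint (-x) := by
  rw [IsEndpoint, IsEndpoint, neg_lower, neg_upper, neg_eq_iff_eq_neg, neg_eq_iff_eq_neg, or_comm]

theorem mem_neg_left : x ∈ (-α).left ↔ -x ∈ α.right := by
  have h : -x ∈ (- -α).right ↔ - -x ∈ (-α).left := Iff.rfl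
  rw [← neg_neg x, ← h, neg_neg, neg_neg]

theorem admissible_of_neg_eq (hα : -α = α) : α.Admissible where
  upper_pos := by
    have hlt : -α.upper < α.upper := lower_eq_neg_upper hα ▸ α.lower_lt_upper
    exact (neg_lt_self_iff (α := ℤ)).mp hlt
  neg_notMem_after x hx hnx := by
    rw [← hα, mem_neg_after, neg_neg, before_eq_sdiff] at hnx
    exact hnx.2 hx
  symmetric_or_neg_upper_notMem_after := Or.inl hα

theorem admissible_of_lower_pos (hα : 0 < α.lower.1) : α.Admissible where
  upper_pos := hα.trans α.lower_lt_upper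
  neg_notMem_after x hx hnx := by
    have hpos : 0 < x.1 := hα.trans_le (α.after_subset_Ico hx).1
    have hneg : 0 < -x.1 := hα.trans_le (α.after_subset_Ico hnx).1
    lia
  symmetric_or_neg_upper_notMem_after := Or.inr fun h => by
    have hpos : 0 < -α.upper.1 := hα.trans_le (α.after_subset_Ico h).1
    have hupper : 0 < α.upper.1 := hα.trans α.lower_lt_upper
    lia

theorem mem_right_or_isEndpoint_of_mem_after (h : x ∈ α.after) : x ∈ α.right ∨ α.IsEndpoint x :=
  h.symm.imp_right Or.inl

theorem eq_lower_of_mem_after (hx : x ∈ α.after) (hend : α.IsEndpoint x) : x = α.lower :=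
  hend.resolve_right (α.after_subset_Ico hx).2.ne

/-- Since `α` and `-α` do not cross, `-α` is nowhere to the right of `α`. -/
theorem isEndpoint_of_rightOf_neg (hcompat : α.Compatible (-α)) (hright : α.RightOf (-α))
    (hx : x ∈ α.right ∨ α.IsEndpoint x) (hnx : -x ∈ α.right ∨ α.IsEndpoint (-x)) :
    α.IsEndpoint x ∧ α.IsEndpoint (-x) := by
  by_contra hend
  refine hcompat.2.2 ⟨hright, x, ?_, hx, fun h => hend ⟨h.2, isEndpoint_neg.mp h.1⟩⟩
  rwa [mem_neg_left, isEndpoint_neg]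

theorem admissible_of_rightOf_neg (hupper : 0 < α.upper.1) (hcompat : α.Compatible (-α))
    (hright : α.RightOf (-α)) : α.Admissible where
  upper_pos := hupper
  neg_notMem_after x hx hnx := by
    obtain ⟨hend, hnend⟩ := isEndpoint_of_rightOf_neg hcompat hright
      (mem_right_or_isEndpoint_of_mem_after hx) (mem_right_or_isEndpoint_of_mem_after hnx)
    exact Pt.neg_ne_self x
      ((eq_lower_of_mem_after hnx hnend).trans (eq_lower_of_mem_after hx hend).symm)
  symmetric_or_neg_upper_notMem_after := Or.inr fun h => by
    have hend := (isEndpoint_of_rightOf_neg hcompat hright (Or.inr (Or.inr rfl))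
      (mem_right_or_isEndpoint_of_mem_after h)).2
    exact hcompat.2.1 (eq_lower_of_mem_after h hend).symm

theorem rightAt_or_rightAt (hx : α.IsEndpoint x) (hβ : x ∈ Set.Ioo β.lower β.upper) :
    α.RightAt β x ∨ β.RightAt α x := by
  have hend : ¬ β.IsEndpoint x := by
    rintro (rfl | rfl)
    exacts [hβ.1.false, hβ.2.false]
  by_cases hright : x ∈ β.right
  · exact Or.inl ⟨Or.inr hx, Or.inl hright, fun h => hend h.2⟩
  · exact Or.inr ⟨Or.inl ⟨hβ, hright⟩, Or.inr hx, fun h => hend h.1⟩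

theorem rightOf_neg_or_neg_rightOf (hlower : α.lower.1 < 0) (hupper : 0 < α.upper.1)
    (hne : α.upper ≠ -α.lower) : α.RightOf (-α) ∨ (-α).RightOf α := by
  have hnlower : 0 < -α.lower.1 := neg_pos.mpr hlower
  have hnupper : -α.upper.1 < 0 := neg_neg_iff_pos.mpr hupper
  rcases lt_or_gt_of_ne hne with hlt | hlt
  · have hmem : α.upper ∈ Set.Ioo (-α).lower (-α).upper := ⟨hnupper.trans hupper, hlt⟩
    exact (rightAt_or_rightAt (Or.inr rfl) hmem).imp (⟨_, ·⟩) (⟨_, ·⟩)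
  · have hmem : -α.lower ∈ Set.Ioo α.lower α.upper := ⟨hlower.trans hnlower, hlt⟩
    exact (rightAt_or_rightAt (α := -α) (Or.inr rfl) hmem).symm.imp (⟨_, ·⟩) (⟨_, ·⟩)

theorem Compatible.symm (h : α.Compatible β) : β.Compatible α :=
  ⟨h.1.symm, h.2.1.symm, fun hcross => h.2.2 hcross.symm⟩

end Arc

section Preferred

variable {α : Arc n} {A : Set (Arc n)}

theorem IsPreferred.admissible (hp : IsPreferred α) (hα : -α = α ∨ α.Compatible (-α)) :
    α.Admissible := by
  rcases hp with hneg | hlower | ⟨hne, -, hupper, hright⟩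
  · exact Arc.admissible_of_neg_eq hneg
  · exact Arc.admissible_of_lower_pos hlower
  · exact Arc.admissible_of_rightOf_neg hupper (hα.resolve_left hne) hright

theorem isPreferred_or_isPreferred_neg (hα : -α = α ∨ α.Compatible (-α)) :
    IsPreferred α ∨ IsPreferred (-α) := by
  by_cases hneg : -α = α
  · exact Or.inl (Or.inl hneg)
  rcases lt_or_gt_of_ne α.lower.2.1.symm with hlower | hlower
  · exact Or.inl (Or.inr (Or.inl hlower))
  rcases lt_or_gt_of_ne α.upper.2.1 with hupper | hupper
  · exact Or.inr (Or.inr (Or.inl (neg_pos.mpr hupper)))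
  refine (Arc.rightOf_neg_or_neg_rightOf hlower hupper (hα.resolve_left hneg).1).imp
    (fun h => Or.inr (Or.inr ⟨hneg, hlower, hupper, h⟩)) fun h => Or.inr (Or.inr ⟨?_, ?_, ?_, ?_⟩)
  · rwa [ne_eq, neg_inj]
  · exact neg_neg_iff_pos.mpr hupper
  · exact neg_pos.mpr hlower
  · rwa [neg_neg]

theorem IsPreferred.exists_oneLine_eq (hp : IsPreferred α) (hα : -α = α ∨ α.Compatible (-α)) :
    ∃ j : SignedPerm n, oneLine j = jiWord α ∧ delta j = {α, -α} := by
  have h := hp.admissible hα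
  obtain ⟨j, hj⟩ := exists_isGrassmannian α.lastRun
  refine ⟨j, ?_, h.delta_eq hj⟩
  rw [hj.oneLine_eq h.neg_notMem_lastRun, h.jiWord_eq (hα.imp_right fun hcompat => hcompat.2.1)]

theorem eq_pair_neg_and_compatible (hA : IsSymmetricArc A ∨ IsSymmetricPair A) (hα : α ∈ A) :
    A = {α, -α} ∧ (-α = α ∨ α.Compatible (-α)) := by
  rcases hA with ⟨β, hβ, rfl⟩ | ⟨β, -, hβ, rfl⟩
  · obtain rfl : α = β := hα
    exact ⟨by rw [hβ, Set.pair_eq_singleton], Or.inl hβ⟩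
  · refine ⟨(pair_neg_eq_of_mem hα).symm, Or.inr ?_⟩
    rcases hα with rfl | rfl
    · exact hβ
    · rw [neg_neg]
      exact hβ.symm

theorem exists_mem_isPreferred (hA : IsSymmetricArc A ∨ IsSymmetricPair A) :
    ∃ α ∈ A, IsPreferred α := by
  obtain ⟨α, hα⟩ : A.Nonempty := by
    rcases hA with ⟨α, -, rfl⟩ | ⟨α, -, -, rfl⟩
    exacts [Set.singleton_nonempty α, Set.insert_nonempty α _]
  obtain ⟨rfl, hcompat⟩ := eq_pair_neg_and_compatible hA hα
  rcases isPreferred_or_isPreferred_neg hcompat with hp | hp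
  exacts [⟨α, Or.inl rfl, hp⟩, ⟨-α, Or.inr rfl, hp⟩]

theorem corresponds_iff (hA : IsSymmetricArc A ∨ IsSymmetricPair A) (j : SignedPerm n) :
    Corresponds j A ↔ delta j = A := by
  have hiff {α : Arc n} (hα : α ∈ A) (hp : IsPreferred α) :
      oneLine j = jiWord α ↔ delta j = A := by
    obtain ⟨hpair, hcompat⟩ := eq_pair_neg_and_compatible hA hα
    obtain ⟨k, hk, hdelta⟩ := hp.exists_oneLine_eq hcompat
    rw [← hk, hpair, ← hdelta, oneLine_injective.eq_iff, delta_injective.eq_iff]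
  constructor
  · rintro ⟨α, hα, hp, hj⟩
    exact (hiff hα hp).mp hj
  · intro hj
    obtain ⟨α, hα, hp⟩ := exists_mem_isPreferred hA
    exact ⟨α, hα, hp, (hiff hα hp).mpr hj⟩

theorem existsUnique_corresponds (hA : IsSymmetricArc A ∨ IsSymmetricPair A) :
    ∃! j : SignedPerm n, Corresponds j A := by
  obtain ⟨α, hα, hp⟩ := exists_mem_isPreferred hA
  obtain ⟨j, hj, -⟩ := hp.exists_oneLine_eq (eq_pair_neg_and_compatible hA hα).2
  have hjA : Corresponds j A := ⟨α, hα, hp, hj⟩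
  refine ⟨j, hjA, fun k hk => delta_injective ?_⟩
  rw [(corresponds_iff hA k).mp hk, (corresponds_iff hA j).mp hjA]

theorem corresponds_iff_isJoinIrreducible_and (hA : IsSymmetricArc A ∨ IsSymmetricPair A)
    (j : SignedPerm n) : Corresponds j A ↔ IsJoinIrreducible j ∧ delta j = A := by
  rw [corresponds_iff hA, iff_and_self]
  intro hj
  obtain ⟨α, hα, -⟩ := exists_mem_isPreferred hA
  exact isJoinIrreducible_of_delta_eq (hj.trans (eq_pair_neg_and_compatible hA hα).1)

theorem pair_neg_mem_symmetricParts {π : SignedPerm n} (hα : α ∈ delta π) :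
    {α, -α} ∈ symmetricParts (delta π) := by
  refine ⟨?_, pair_neg_subset_delta hα⟩
  by_cases hneg : -α = α
  · exact Or.inl ⟨α, hneg, by rw [hneg, Set.pair_eq_singleton]⟩
  · exact Or.inr ⟨α, hneg, compatible_of_mem_delta hα (neg_mem_delta hα) (Ne.symm hneg), rfl⟩

theorem isCanonicalJoinRep_setOf_corresponds (π : SignedPerm n) :
    IsCanonicalJoinRep π {j | ∃ A ∈ symmetricParts (delta π), Corresponds j A} := by
  refine isCanonicalJoinRep_of_delta ?_ fun α hα => ?_
  · rintro j ⟨A, ⟨hA, hAπ⟩, hj⟩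
    obtain ⟨α, hα, -⟩ := exists_mem_isPreferred hA
    rw [corresponds_iff hA, (eq_pair_neg_and_compatible hA hα).1] at hj
    exact ⟨α, hAπ hα, hj⟩
  · have hA := pair_neg_mem_symmetricParts hα
    obtain ⟨j, hj, -⟩ := existsUnique_corresponds hA.1
    exact ⟨j, ⟨_, hA, hj⟩, (corresponds_iff hA.1 j).mp hj⟩

end Preferred

end TypeB

theorem theoremB_general (n : ℕ) (π : SignedPerm n) :
    (∀ A : Set (Arc n), IsSymmetricArc A ∨ IsSymmetricPair A →
      (∃! j : SignedPerm n, Corresponds j A) ∧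
      ∀ j : SignedPerm n, Corresponds j A ↔ IsJoinIrreducible j ∧ delta j = A) ∧
    IsCanonicalJoinRep π {j | ∃ A ∈ symmetricParts (delta π), Corresponds j A} :=
  ⟨fun _ hA => ⟨existsUnique_corresponds hA, corresponds_iff_isJoinIrreducible_and hA⟩,
    isCanonicalJoinRep_setOf_corresponds π⟩

/-- The first part says that each symmetric arc or pair `A` of `δ(π)` has exactly one
corresponding signed permutation, and that this is the join-irreducible element `j` with
`δ(j) = A`; the second part describes the canonical join representation of `π`. -/
theorem theoremB (n : ℕ) (π : SignedPerm n) :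
    (∀ A ∈ symmetricParts (delta π),
      (∃! j : SignedPerm n, Corresponds j A) ∧
      ∀ j : SignedPerm n, Corresponds j A ↔ IsJoinIrreducible j ∧ delta j = A) ∧
    IsCanonicalJoinRep π {j | ∃ A ∈ symmetricParts (delta π), Corresponds j A} :=
  ⟨fun A hA => (theoremB_general n π).1 A hA.1, (theoremB_general n π).2⟩
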